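/- Let $p$ be a prime, let $K$ be an ultrametric extension of $\mathbf{Q}_p$ (a field extension with an absolute value extending that of $\mathbf{Q}_p$; completeness is not required), and let $P(T)=\sum_{n=1}^{D}a_nT^n\in K[T]$ with $D\ge 1$ (the degree of $P$ is at most $D$, and there is no constant term). For $1\le n\le D$ let $d_n=\lfloor\log_p(D/n)\rfloor$. Let $\zeta$ be a root of unity of order $p^{d_1+1}$ in an ultrametric extension $L$ of $K$, and put $\zeta_{d_1-j}=\zeta^{p^j}$ for $0\le j\le d_1$. Define $$\widetilde P(T)=\sum_{n=1}^{D}\frac{a_n}{\zeta_{d_n}-1}T^n,\qquad e(T)=\exp(P(T))=\sum_{i\ge0}b_iT^i,\qquad \widetilde e(T)=1+\sum_{i=1}^{D}\widetilde b_iT^i\equiv\exp(\widetilde P(T))\pmod{T^{D+1}},$$ and let $(u_1,\dots,u_D)\in L^D$ be the truncated universal Witt vector of $\widetilde e$, i.e. the unique family with $\widetilde e(T)\equiv\prod_{n=1}^{D}(1-u_nT^n)\pmod{T^{D+1}}$. Let $\rho\in[0,\infty]$ be the radius of convergence of $e(T)$, and define $\iota,\widetilde\iota\in[0,\infty]$ by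 $$\frac1\iota=\sup_{i\ge1}|b_i|^{1/i},\qquad \frac1{\widetilde\iota}=\sup_{1\le i\le D}|\widetilde b_i|^{1/i}$$ (with $1/\infty=0$). Then $$\rho=\iota=\widetilde\iota=\Bigl(\sup_{1\le i\le D}|u_i|^{1/i}\Bigr)^{-1}.$$ In particular, $e(T)$ has radius of convergence at least $1$ if and only if all its coefficients $b_i$ satisfy $|b_i|\le1$. (The case where $D=p^d$ and $P(T)=\alpha_0T+\alpha_1T^p+\dots+\alpha_dT^{p^d}$ gives $\widetilde P(T)=\sum_{i=0}^{d}\frac{\alpha_i}{\zeta^{p^i}-1}T^{p^i}$.) -/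

import Mathlib

open PowerSeries
open scoped ENNReal

namespace PadicExp

/-- The formal exponential `exp(f(T))` of a power series `f` without constant term: the series
`exp(X)` with `f` substituted for `X`. -/
noncomputable def expSeries {F : Type*} [Field F] [CharZero F] (f : PowerSeries F) :
    PowerSeries F :=
  (PowerSeries.exp F).subst f

/-- The radius of convergence, in `[0, ∞]`, of a power series over a normed field. -/
noncomputable def convRadius {F : Type*} [NontriviallyNormedField F] (f : PowerSeries F) : ℝ≥0∞ :=
  (FormalMultilinearSeries.ofScalars F (fun n => coeff n f)).radius

/-- The inverse, in `[0, ∞]`, of `sup_{i ∈ s} |a_i|^{1/i}` (with `1/0 = ∞`). It is used only for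
sets `s` of positive integers. -/
noncomputable def invSupRoot {F : Type*} [NormedField F] (s : Set ℕ) (a : ℕ → F) : ℝ≥0∞ :=
  (⨆ i ∈ s, ‖a i‖ₑ ^ (1 / (i : ℝ)))⁻¹

/-- The integrality radius `ι` of a power series `∑ b_i T^i` with `b_0 = 1`:
`1 / ι = sup_{i ≥ 1} |b_i|^{1/i}`. -/
noncomputable def integralityRadius {F : Type*} [NormedField F] (f : PowerSeries F) : ℝ≥0∞ :=
  invSupRoot (Set.Ici 1) (fun i => coeff i f)

/-- `d_n = ⌊log_p (D / n)⌋`, the largest `k` with `n * p ^ k ≤ D` (for `1 ≤ n ≤ D`). -/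
def dIndex (p D n : ℕ) : ℕ := Nat.log p (D / n)

/-- The polynomial `P̃(T) = ∑_{1 ≤ n ≤ D} a_n / (ζ_{d_n} - 1) T^n` attached to
`P(T) = ∑_{1 ≤ n ≤ D} a_n T^n` and to a root of unity `ζ = ζ_{d_1}` of order `p ^ (d_1 + 1)`,
where `ζ_{d_1 - j} = ζ ^ (p ^ j)`. -/
noncomputable def tildePoly (p D : ℕ) {K L : Type*} [Field K] [Field L] [Algebra K L]
    (ζ : L) (P : Polynomial K) : Polynomial L :=
  ∑ n ∈ Finset.Icc 1 D, Polynomial.monomial n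
    (algebraMap K L (P.coeff n) / (ζ ^ p ^ (dIndex p D 1 - dIndex p D n) - 1))

/-- The truncated series `ẽ(T)`: the terms of degree at most `D` of `exp(P̃(T))`. -/
noncomputable def tildeExp (p D : ℕ) {K L : Type*} [Field K] [Field L] [CharZero L] [Algebra K L]
    (ζ : L) (P : Polynomial K) : Polynomial L :=
  trunc (D + 1) (expSeries (tildePoly p D ζ P : PowerSeries L))

/-- The universal Witt coordinates `u_1, u_2, …` of a power series `f` with constant term `1`,
that is, the elements with `f = ∏_{n ≥ 1} (1 - u_n T^n)`, computed recursively
(the entry at index `0` is a dummy `0`). See `prod_wittCoord` and `eq_wittCoord`. -/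
noncomputable def wittCoord {F : Type*} [Field F] (f : PowerSeries F) : ℕ → F
  | 0 => 0
  | n + 1 => coeff (n + 1) (∏ i : Fin (n + 1), (1 - C (wittCoord f i.1) * X ^ i.1))
      - coeff (n + 1) f

theorem wittCoord_succ {F : Type*} [Field F] (f : PowerSeries F) (n : ℕ) :
    wittCoord f (n + 1) =
      coeff (n + 1) (∏ i ∈ Finset.Icc 1 n, (1 - C (wittCoord f i) * X ^ i)) - coeff (n + 1) f := by
  rw [wittCoord, Fin.prod_univ_eq_prod_range (fun i => (1 - C (wittCoord f i) * X ^ i)) (n + 1),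
    Finset.prod_range_succ']
  have h : wittCoord f 0 = 0 := by rw [wittCoord]
  rw [h, Finset.range_eq_Ico, Finset.prod_Ico_add' (fun i => (1 - C (wittCoord f i) * X ^ i)) 0 n 1,
    map_zero, zero_mul, sub_zero, mul_one]
  rfl

theorem coeff_mul_one_sub {F : Type*} [Field F] (g : PowerSeries F) (c : F) (n m : ℕ) (h : m ≤ n)
    (hg : constantCoeff g = 1) :
    coeff m (g * (1 - C c * X ^ n)) = coeff m g - if m = n then c else 0 := by
  rw [mul_sub, mul_one, map_sub, mul_left_comm, coeff_C_mul, coeff_mul_X_pow']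
  rcases h.lt_or_eq with h | h
  · simp [h.not_ge, h.ne]
  · subst h; simp [hg]

theorem constantCoeff_prod {F : Type*} [Field F] (u : ℕ → F) (D : ℕ) :
    constantCoeff (∏ n ∈ Finset.Icc 1 D, (1 - C (u n) * X ^ n)) = 1 := by
  rw [map_prod]
  refine Finset.prod_eq_one fun n hn => ?_
  have : n ≠ 0 := by have := Finset.mem_Icc.1 hn; omega
  simp [this]

/-- The Witt coordinates up to `D` represent `f` modulo `T^{D+1}`. -/
theorem prod_wittCoord {F : Type*} [Field F] (f : PowerSeries F) (hf : constantCoeff f = 1)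
    (D m : ℕ) (hm : m ≤ D) :
    coeff m (∏ n ∈ Finset.Icc 1 D, (1 - C (wittCoord f n) * X ^ n)) = coeff m f := by
  induction D with
  | zero =>
    obtain rfl : m = 0 := by omega
    simpa using hf.symm
  | succ D ih =>
    rw [Finset.prod_Icc_succ_top (by omega), coeff_mul_one_sub _ _ _ _ hm (constantCoeff_prod _ _)]
    rcases hm.lt_or_eq with h | h
    · rw [if_neg h.ne, sub_zero, ih (by omega)]
    · subst h
      rw [if_pos rfl, wittCoord_succ, sub_sub_cancel]

/-- The Witt coordinates up to `D` are the only elements that represent `f` modulo `T^{D+1}`. -/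
theorem eq_wittCoord {F : Type*} [Field F] (f : PowerSeries F) (D : ℕ) (u : ℕ → F)
    (hu : ∀ m ≤ D, coeff m (∏ n ∈ Finset.Icc 1 D, (1 - C (u n) * X ^ n)) = coeff m f)
    (n : ℕ) (hn : n ∈ Finset.Icc 1 D) : u n = wittCoord f n := by
  induction D generalizing n with
  | zero => simp at hn
  | succ D ih =>
    have key : ∀ m ≤ D + 1, coeff m (∏ n ∈ Finset.Icc 1 D, (1 - C (u n) * X ^ n))
        - (if m = D + 1 then u (D + 1) else 0) = coeff m f := fun m hm => by
      rw [← hu m hm, Finset.prod_Icc_succ_top (by omega),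
        coeff_mul_one_sub _ _ _ _ hm (constantCoeff_prod _ _)]
    have ih' := ih fun m hm => by
      have := key m (by omega)
      rwa [if_neg (by omega), sub_zero] at this
    rcases (Finset.mem_Icc.1 hn).2.lt_or_eq with h | h
    · exact ih' n (Finset.mem_Icc.2 ⟨(Finset.mem_Icc.1 hn).1, by omega⟩)
    · subst h
      have := key (D + 1) le_rfl
      rw [if_pos rfl] at this
      rw [wittCoord_succ, ← this]
      rw [Finset.prod_congr rfl fun i hi => by rw [← ih' i hi]]
      ring

end PadicExp

/-! Let `ℓ = T + T^p/p + T^(p^2)/p^2 + …` and let `E = exp ℓ` be the Artin–Hasse exponential, whose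
coefficients are `p`-integral. Since `ℓ = T + …`, there are `v_1, …, v_D` with `P̃ ≡ ∑ ℓ(v_m T^m)`
modulo `T^(D+1)`. Put `z_m = ζ_{d_m}`. The indices `d_m` are chosen so that `z_m ^ (p^i)` depends
only on `n = m p^i`: it is `z_n` if `n ≤ D` and `1` if `n > D`. Hence `∑ (ℓ(z_m v_m T^m) - ℓ(v_m
T^m))` has `n`-th coefficient `(z_n - 1) P̃_n = a_n` for `n ≤ D` and `0` beyond, so it is exactly
`P`. This gives `e = ∏ E(z_m v_m T^m) / E(v_m T^m)` (`map_expSeries_mul_prod_dilate`).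

Every radius in the theorem is governed by the condition `|v_m| ≤ r^m` for all `m ≤ D`. For `ẽ ≡ ∏
E(v_m T^m)` and for its Witt coordinates this is unitriangularity
(`forall_coeff_prod_dilate_le_iff`, applied to `E` and to `1 - T`). For `e`, integrality of `E`
gives `|b_i| ≤ r^i`.

The converse (`norm_le_of_growthBound_prod`) is the main point: a bound `|b_i| ≤ c s^i`, with any
constant `c`, forces `|v_m| ≤ s^m`. Otherwise `r = max |v_m|^(1/m) > s`. The factors with `|v_m| <
r^m` can be divided out. For the others, to first order, `E(zvT^m)/E(vT^m) = 1 + (z - 1) N(vT^m) +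
…` with `N = T + T^p + T^(p^2) + …`. If `m₀` is the least remaining index, the coefficients in the
degrees `m₀ p^j` have absolute value exactly `|z_{m₀} - 1| r^(m₀ p^j)`, too large for the bound `c
s^i`. As `c` is arbitrary, the radius of convergence and the integrality radius coincide. -/

namespace PadicExp

/-! ### Formal exponentials and the substitutions `f(uT^n)` -/

section Formal

variable {F : Type*} [Field F] [CharZero F]

theorem constantCoeff_expSeries {f : PowerSeries F} (hf : constantCoeff f = 0) :
    constantCoeff (expSeries f) = 1 := by
  have h := HasSubst.of_constantCoeff_zero' hf
  have h1 : (PowerSeries.exp F).subst f = ((PowerSeries.exp F - 1).subst f) + 1 := by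
    rw [subst_sub h, ← coe_substAlgHom h, map_one, sub_add_cancel]
  rw [expSeries, h1, map_add]
  have := constantCoeff_subst_eq_zero (a := f) hf (PowerSeries.exp F - 1) (by simp)
  erw [this]
  simp

theorem derivative_expSeries {f : PowerSeries F} (hf : constantCoeff f = 0) :
    d⁄dX F (expSeries f) = expSeries f * d⁄dX F f := by
  rw [expSeries, derivative_subst (HasSubst.of_constantCoeff_zero' hf), derivative_exp]

/-- Modulo `T^{D+1}`, a solution of `g' = g f'` with `g(0) = 1` depends only on `f`. -/
theorem coeff_eq_of_derivative_eq {f₁ f₂ g₁ g₂ : PowerSeries F} {D : ℕ}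
    (hf : ∀ m, 1 ≤ m → m ≤ D → coeff m f₁ = coeff m f₂)
    (h₁ : constantCoeff g₁ = 1) (h₂ : constantCoeff g₂ = 1)
    (hg₁ : d⁄dX F g₁ = g₁ * d⁄dX F f₁) (hg₂ : d⁄dX F g₂ = g₂ * d⁄dX F f₂)
    (m : ℕ) (hm : m ≤ D) : coeff m g₁ = coeff m g₂ := by
  induction m using Nat.strong_induction_on with
  | _ m ih =>
    rcases m with _ | m
    · simp [h₁, h₂]
    · have e₁ := congrArg (coeff m) hg₁
      have e₂ := congrArg (coeff m) hg₂
      rw [coeff_derivative, coeff_mul] at e₁ e₂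
      have h0 : ((m : F) + 1) ≠ 0 := by exact_mod_cast Nat.succ_ne_zero m
      apply mul_right_cancel₀ h0
      rw [e₁, e₂]
      refine Finset.sum_congr rfl fun x hx => ?_
      have hx := Finset.HasAntidiagonal.mem_antidiagonal.1 hx
      rw [ih x.1 (by omega) (by omega), coeff_derivative, coeff_derivative,
        hf (x.2 + 1) (by omega) (by omega)]

/-- Uniqueness for the equation `g' = g f'` replaces manipulations of the exponential series: the
functional equation below follows by differentiating. -/
theorem eq_expSeries {f g : PowerSeries F} (hf : constantCoeff f = 0) (h : constantCoeff g = 1)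
    (hg : d⁄dX F g = g * d⁄dX F f) : g = expSeries f := by
  ext m
  exact coeff_eq_of_derivative_eq (D := m) (fun _ _ _ => rfl) h (constantCoeff_expSeries hf) hg
    (derivative_expSeries hf) m le_rfl

theorem coeff_expSeries_congr {f₁ f₂ : PowerSeries F} {D : ℕ} (h₁ : constantCoeff f₁ = 0)
    (h₂ : constantCoeff f₂ = 0) (hf : ∀ m, 1 ≤ m → m ≤ D → coeff m f₁ = coeff m f₂)
    (m : ℕ) (hm : m ≤ D) : coeff m (expSeries f₁) = coeff m (expSeries f₂) :=
  coeff_eq_of_derivative_eq hf (constantCoeff_expSeries h₁) (constantCoeff_expSeries h₂)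
    (derivative_expSeries h₁) (derivative_expSeries h₂) m hm

theorem expSeries_zero : expSeries (0 : PowerSeries F) = 1 :=
  (eq_expSeries (map_zero _) (map_one _) (by simp)).symm

theorem expSeries_add {f g : PowerSeries F} (hf : constantCoeff f = 0)
    (hg : constantCoeff g = 0) : expSeries (f + g) = expSeries f * expSeries g := by
  refine (eq_expSeries (by simp [hf, hg])
    (by simp [constantCoeff_expSeries hf, constantCoeff_expSeries hg]) ?_).symm
  rw [Derivation.leibniz, derivative_expSeries hf, derivative_expSeries hg, map_add]
  simp only [smul_eq_mul]
  ring

theorem expSeries_sum {ι : Type*} (s : Finset ι) (f : ι → PowerSeries F)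
    (hf : ∀ i ∈ s, constantCoeff (f i) = 0) :
    expSeries (∑ i ∈ s, f i) = ∏ i ∈ s, expSeries (f i) := by
  classical
  induction s using Finset.induction_on with
  | empty => simp [expSeries_zero]
  | insert a s ha ih =>
    rw [Finset.sum_insert ha, Finset.prod_insert ha, expSeries_add (hf a (by simp)),
      ih fun i hi => hf i (by simp [hi])]
    rw [map_sum]
    exact Finset.sum_eq_zero fun i hi => hf i (by simp [hi])

theorem expSeries_nsmul {f : PowerSeries F} (hf : constantCoeff f = 0) (n : ℕ) :
    expSeries (n • f) = expSeries f ^ n := by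
  have := expSeries_sum (Finset.range n) (fun _ => f) fun _ _ => hf
  simpa using this

theorem map_expSeries {F' : Type*} [Field F'] [CharZero F'] (φ : F →+* F') {f : PowerSeries F}
    (hf : constantCoeff f = 0) :
    PowerSeries.map φ (expSeries f) = expSeries (PowerSeries.map φ f) := by
  have := map_subst (HasSubst.of_constantCoeff_zero' hf) (h := φ) (PowerSeries.exp F)
  rw [map_exp] at this
  exact this

/-- The series `f(u T^n)`. -/
noncomputable def dilate (u : F) (n : ℕ) (f : PowerSeries F) : PowerSeries F :=
  (rescale u f).subst (X ^ n : PowerSeries F)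

omit [CharZero F] in
theorem coeff_dilate (u : F) {n : ℕ} (hn : n ≠ 0) (f : PowerSeries F) (i : ℕ) :
    coeff i (dilate u n f) = if n ∣ i then u ^ (i / n) * coeff (i / n) f else 0 := by
  rw [dilate, coeff_subst_X_pow hn]
  simp [coeff_rescale]

omit [CharZero F] in
theorem constantCoeff_dilate (u : F) {n : ℕ} (hn : n ≠ 0) (f : PowerSeries F) :
    constantCoeff (dilate u n f) = constantCoeff f := by
  rw [← coeff_zero_eq_constantCoeff_apply, coeff_dilate u hn]
  simp

omit [CharZero F] in
theorem dilate_mul (u : F) {n : ℕ} (hn : n ≠ 0) (f g : PowerSeries F) :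
    dilate u n (f * g) = dilate u n f * dilate u n g := by
  rw [dilate, map_mul, subst_mul (HasSubst.X_pow hn)]; rfl

theorem dilate_expSeries (u : F) {n : ℕ} (hn : n ≠ 0) {f : PowerSeries F}
    (hf : constantCoeff f = 0) : dilate u n (expSeries f) = expSeries (dilate u n f) := by
  have hf' := HasSubst.of_constantCoeff_zero' hf
  rw [dilate, dilate, expSeries, expSeries, rescale_eq_subst, rescale_eq_subst,
    subst_comp_subst_apply hf' (HasSubst.smul_X' u), subst_comp_subst_apply _ (HasSubst.X_pow hn)]
  rw [← rescale_eq_subst]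
  exact HasSubst.of_constantCoeff_zero' (by
    rw [← coeff_zero_eq_constantCoeff_apply, coeff_rescale]; simp [hf])

end Formal

/-! ### Isobaric coefficient bounds over an ultrametric field -/

section Growth

variable {F : Type*} [NormedField F]

/-- The coefficients of `f` satisfy `|f_i| ≤ c r^i`. -/
def GrowthBound (c r : ℝ) (f : PowerSeries F) : Prop := ∀ i, ‖coeff i f‖ ≤ c * r ^ i

namespace GrowthBound

variable {c c' r s : ℝ} {f g : PowerSeries F}

theorem mono (h : GrowthBound c r f) (hc : c ≤ c') (hr : 0 ≤ r) : GrowthBound c' r f := fun i =>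
  (h i).trans (mul_le_mul_of_nonneg_right hc (pow_nonneg hr i))

theorem mono_right (h : GrowthBound c r f) (hc : 0 ≤ c) (hr : 0 ≤ r) (hrs : r ≤ s) :
    GrowthBound c s f := fun i =>
  (h i).trans (mul_le_mul_of_nonneg_left (pow_le_pow_left₀ hr hrs i) hc)

theorem one (hr : 0 ≤ r) : GrowthBound 1 r (1 : PowerSeries F) := fun i => by
  rw [coeff_one]
  split_ifs with h
  · simp [h]
  · simp [hr]

theorem C_mul (h : GrowthBound c r f) (a : F) : GrowthBound (‖a‖ * c) r (C a * f) := fun i => by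
  rw [coeff_C_mul, norm_mul, mul_assoc]
  exact mul_le_mul_of_nonneg_left (h i) (norm_nonneg a)

theorem dilate (h : GrowthBound c 1 f) (hc : 0 ≤ c) {u : F} {n : ℕ} (hn : n ≠ 0) (hr : 0 ≤ r)
    (hu : ‖u‖ ≤ r ^ n) : GrowthBound c r (dilate u n f) := fun i => by
  rw [coeff_dilate u hn]
  split_ifs with hi
  · obtain ⟨k, rfl⟩ := hi
    rw [Nat.mul_div_cancel_left k (Nat.pos_of_ne_zero hn), norm_mul, norm_pow, mul_comm c, pow_mul]
    exact mul_le_mul (pow_le_pow_left₀ (norm_nonneg u) hu k) (by simpa using h k) (norm_nonneg _)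
      (by positivity)
  · rw [norm_zero]; positivity

variable [IsUltrametricDist F]

theorem add (hf : GrowthBound c r f) (hg : GrowthBound c r g) : GrowthBound c r (f + g) :=
  fun i => by
    rw [map_add]
    exact (IsUltrametricDist.norm_add_le_max _ _).trans (max_le (hf i) (hg i))

omit [IsUltrametricDist F] in
theorem neg (hf : GrowthBound c r f) : GrowthBound c r (-f) := fun i => by
  rw [map_neg, norm_neg]; exact hf i

theorem sub (hf : GrowthBound c r f) (hg : GrowthBound c r g) : GrowthBound c r (f - g) := by
  rw [sub_eq_add_neg]; exact hf.add hg.neg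

theorem mul (hf : GrowthBound c r f) (hg : GrowthBound c' r g) (hc : 0 ≤ c) (hc' : 0 ≤ c')
    (hr : 0 ≤ r) : GrowthBound (c * c') r (f * g) := fun i => by
  rw [coeff_mul]
  refine IsUltrametricDist.norm_sum_le_of_forall_le_of_nonneg (by positivity) fun x hx => ?_
  have hx := Finset.HasAntidiagonal.mem_antidiagonal.1 hx
  rw [norm_mul, ← hx, pow_add, mul_mul_mul_comm]
  exact mul_le_mul (hf x.1) (hg x.2) (norm_nonneg _) (by positivity)

theorem mul_one_left (hf : GrowthBound 1 r f) (hg : GrowthBound c r g) (hc : 0 ≤ c)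
    (hr : 0 ≤ r) : GrowthBound c r (f * g) := by
  simpa using hf.mul hg zero_le_one hc hr

theorem prod {ι : Type*} {t : Finset ι} {f : ι → PowerSeries F} (hr : 0 ≤ r)
    (h : ∀ i ∈ t, GrowthBound 1 r (f i)) : GrowthBound 1 r (∏ i ∈ t, f i) := by
  classical
  induction t using Finset.induction_on with
  | empty => simpa using one hr
  | insert a t ha ih =>
    rw [Finset.prod_insert ha]
    exact (h a (by simp)).mul_one_left (ih fun i hi => h i (by simp [hi])) zero_le_one hr

/-- With constant term `1` the recursion for the coefficients of the inverse involves no division,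
so the ultrametric inequality propagates the bound. -/
theorem inv (hf : GrowthBound 1 r f) (hr : 0 ≤ r) (h0 : constantCoeff f = 1) :
    GrowthBound 1 r f⁻¹ := fun i => by
  induction i using Nat.strong_induction_on with
  | _ i ih =>
    rw [coeff_inv]
    split_ifs with hi
    · simp [h0, hi]
    · rw [h0, inv_one, norm_mul, norm_neg, norm_one, one_mul]
      refine IsUltrametricDist.norm_sum_le_of_forall_le_of_nonneg (by positivity) fun x hx => ?_
      have hx := Finset.HasAntidiagonal.mem_antidiagonal.1 hx
      split_ifs with h
      · rw [norm_mul, ← hx, pow_add, ← mul_one (1 : ℝ), mul_mul_mul_comm]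
        exact mul_le_mul (hf x.1) (by simpa using ih x.2 h) (norm_nonneg _) (by positivity)
      · rw [norm_zero]; positivity

end GrowthBound

end Growth

/-! ### The Artin–Hasse exponential and its integrality -/

section ArtinHasse

variable (p : ℕ) [hp : Fact p.Prime]

/-- The series `T + T^p / p + T^(p^2) / p^2 + …`. -/
noncomputable def artinHasseLog (F : Type*) [Field F] : PowerSeries F :=
  PowerSeries.mk fun k => if k = p ^ Nat.log p k then (k : F)⁻¹ else 0

/-- The Artin–Hasse exponential. -/
noncomputable def artinHasse (F : Type*) [Field F] [CharZero F] : PowerSeries F :=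
  expSeries (artinHasseLog p F)

variable {p} {F : Type*} [Field F]

omit hp in
theorem constantCoeff_artinHasseLog : constantCoeff (artinHasseLog p F) = 0 := by
  rw [← coeff_zero_eq_constantCoeff_apply, artinHasseLog, coeff_mk]
  simp

theorem coeff_artinHasseLog_pow (i : ℕ) :
    coeff (p ^ i) (artinHasseLog p F) = ((p : F) ^ i)⁻¹ := by
  rw [artinHasseLog, coeff_mk, Nat.log_pow hp.out.one_lt]
  simp

omit hp in
theorem coeff_artinHasseLog_ne {k : ℕ} (h : ∀ i, k ≠ p ^ i) :
    coeff k (artinHasseLog p F) = 0 := by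
  rw [artinHasseLog, coeff_mk, if_neg (h _)]

variable [CharZero F]

omit hp in
theorem constantCoeff_artinHasse : constantCoeff (artinHasse p F) = 1 :=
  constantCoeff_expSeries constantCoeff_artinHasseLog

omit hp in
theorem map_artinHasse {F' : Type*} [Field F'] [CharZero F'] (φ : F →+* F') :
    PowerSeries.map φ (artinHasse p F) = artinHasse p F' := by
  rw [artinHasse, map_expSeries φ constantCoeff_artinHasseLog, artinHasse]
  congr 1
  ext k
  rw [coeff_map, artinHasseLog, artinHasseLog, coeff_mk, coeff_mk, apply_ite φ]
  simp

theorem coeff_one_artinHasse : coeff 1 (artinHasse p F) = 1 := by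
  have h := congrArg (coeff 0) (derivative_expSeries (F := F)
    (constantCoeff_artinHasseLog (p := p)))
  rw [coeff_derivative] at h
  have h1 := coeff_artinHasseLog_pow (p := p) (F := F) 0
  have h2 := constantCoeff_artinHasse (p := p) (F := F)
  rw [artinHasse] at h2 ⊢
  simp only [pow_zero] at h1
  have h3 := coeff_derivative (artinHasseLog p F) 0
  simp only [coeff_zero_eq_constantCoeff, zero_add, h1] at h3
  simpa [h2, h3] using h

/-- This is the exponential of the identity `p ℓ(T) = ℓ(T^p) + pT`, the input to Dwork's integrality
argument. -/
theorem artinHasse_pow_prime :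
    artinHasse p F ^ p = dilate 1 p (artinHasse p F) * expSeries (C (p : F) * X) := by
  have hp0 := hp.out.ne_zero
  have hF : (p : F) ≠ 0 := by exact_mod_cast hp0
  have h0 := constantCoeff_artinHasseLog (p := p) (F := F)
  rw [artinHasse, ← expSeries_nsmul h0, dilate_expSeries _ hp0 h0, ← expSeries_add
    (by rw [constantCoeff_dilate _ hp0, h0]) (by simp)]
  congr 1
  ext k
  rw [map_add, coeff_C_mul, coeff_X, map_nsmul, coeff_dilate _ hp0, nsmul_eq_mul, one_pow, one_mul]
  by_cases hk : ∃ i, k = p ^ i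
  · obtain ⟨i, rfl⟩ := hk
    rw [coeff_artinHasseLog_pow]
    rcases i with _ | i
    · rw [if_neg (by simpa using hp.out.ne_one)]
      simp
    · rw [if_pos (dvd_pow_self p (by omega)), pow_succ p i, Nat.mul_div_cancel _ hp.out.pos,
        coeff_artinHasseLog_pow, if_neg]
      · rw [mul_zero, add_zero, pow_succ, mul_inv]; field_simp
      · intro h
        exact hp.out.ne_one (Nat.eq_one_of_mul_eq_one_left h)
  · push Not at hk
    rw [coeff_artinHasseLog_ne hk, mul_zero]
    have h1 : k ≠ 1 := by simpa using hk 0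
    rw [if_neg h1, mul_zero, add_zero]
    split_ifs with hd
    · obtain ⟨l, rfl⟩ := hd
      rw [Nat.mul_div_cancel_left _ hp.out.pos, coeff_artinHasseLog_ne]
      intro i hi
      exact hk (i + 1) (by rw [hi, pow_succ'])
    · rfl

/-- The `p`-adic valuation of `n!` is less than `n`; hence `exp(pT) ≡ 1` modulo `p`. -/
theorem norm_pow_div_factorial_le {n : ℕ} (hn : n ≠ 0) :
    ‖(p : ℚ_[p]) ^ n / (n.factorial : ℚ_[p])‖ ≤ ‖(p : ℚ_[p])‖ := by
  have h := padicValNat_factorial_lt_of_ne_zero (p := p) hn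
  have hf : ((n.factorial : ℕ) : ℚ_[p]) ≠ 0 := by exact_mod_cast n.factorial_ne_zero
  have hp1 : (1 : ℝ) < p := by exact_mod_cast hp.out.one_lt
  rw [norm_div, norm_pow, Padic.norm_p, Padic.norm_eq_zpow_neg_valuation hf,
    Padic.valuation_natCast, inv_pow, ← zpow_natCast, ← zpow_neg, ← zpow_sub₀ (by positivity),
    ← zpow_neg_one]
  exact zpow_le_zpow_right₀ hp1.le (by omega)

theorem coeff_expSeries_C_mul_X (a : F) (n : ℕ) :
    coeff n (expSeries (C a * X)) = a ^ n / (n.factorial : F) := by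
  rw [expSeries, ← smul_eq_C_mul, ← rescale_eq_subst, coeff_rescale, coeff_exp]
  simp [div_eq_mul_inv]

/-- Frobenius congruence: `f(T)^p ≡ f(T^p)` modulo `p` for `f` with coefficients in `ℤ_p`. -/
theorem GrowthBound.pow_prime_sub {f : PowerSeries ℚ_[p]} (hf : GrowthBound 1 1 f) :
    GrowthBound ‖(p : ℚ_[p])‖ 1 (f ^ p - PadicExp.dilate 1 p f) := by
  obtain ⟨g, rfl⟩ : ∃ g : PowerSeries ℤ_[p], f = PowerSeries.map PadicInt.Coe.ringHom g := by
    have h : ∀ i, ∃ x : ℤ_[p], PadicInt.Coe.ringHom x = coeff i f := fun i =>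
      ⟨⟨coeff i f, by simpa using hf i⟩, rfl⟩
    choose a ha using h
    exact ⟨PowerSeries.mk a, by ext i; rw [coeff_map, coeff_mk, ha]⟩
  have hp0 := hp.out.ne_zero
  have h1 : PadicExp.dilate 1 p (PowerSeries.map PadicInt.Coe.ringHom g)
      = PowerSeries.map PadicInt.Coe.ringHom (expand p hp0 g) := by
    rw [map_expand, expand_apply, PadicExp.dilate, rescale_one]; rfl
  -- Over the residue field `𝔽_p` the `p`-th power is a ring homomorphism fixing the coefficients,
  -- so the difference vanishes there.
  have h2 : PowerSeries.map (PadicInt.toZMod (p := p)) (g ^ p - expand p hp0 g) = 0 := by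
    rw [map_sub, map_pow, map_expand, sub_eq_zero]
    have := MvPowerSeries.map_frobenius_expand p hp0
      (f := PowerSeries.map (PadicInt.toZMod (p := p)) g)
    rw [ZMod.frobenius_zmod] at this
    rw [expand, PowerSeries] at *
    rw [← this, MvPowerSeries.map_id]; rfl
  rw [h1, ← map_pow, ← map_sub]
  intro i
  have h3 := congrArg (coeff i) h2
  rw [coeff_map, map_zero, ← RingHom.mem_ker, PadicInt.ker_toZMod,
    PadicInt.maximalIdeal_eq_span_p, Ideal.mem_span_singleton] at h3
  obtain ⟨x, hx⟩ := h3
  rw [coeff_map, hx, map_mul, norm_mul, one_pow]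
  refine mul_le_mul (by simp) x.2 (norm_nonneg _) (norm_nonneg _)

/-- The Artin–Hasse exponential has `p`-integral coefficients. -/
theorem growthBound_artinHasse_padic : GrowthBound 1 1 (artinHasse p ℚ_[p]) := fun n => by
  have hp0 := hp.out.ne_zero
  have hp1 : (p : ℚ_[p]) ≠ 0 := by exact_mod_cast hp0
  rw [one_pow, mul_one]
  induction n using Nat.strong_induction_on with
  | _ n ih =>
  rcases Nat.eq_zero_or_pos n with rfl | hn
  · simp [constantCoeff_artinHasse]
  set e := artinHasse p ℚ_[p] with he
  set g : PowerSeries ℚ_[p] := (trunc n e : PowerSeries ℚ_[p]) with hg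
  set h : PowerSeries ℚ_[p] := expSeries (C (p : ℚ_[p]) * X) with hh
  have hgc : ∀ i, coeff i g = if i < n then coeff i e else 0 := fun i => by
    rw [hg, Polynomial.coeff_coe, coeff_trunc]
  have hg1 : GrowthBound 1 1 g := fun i => by
    rw [hgc, one_pow, mul_one]
    split_ifs with hi
    · exact ih i hi
    · simp
  have hd1 : GrowthBound 1 1 (dilate 1 p g) := hg1.dilate zero_le_one hp0 zero_le_one (by simp)
  have hexp : GrowthBound ‖(p : ℚ_[p])‖ 1 (h - 1) := fun i => by
    rw [map_sub, hh, coeff_expSeries_C_mul_X, one_pow, mul_one, coeff_one]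
    rcases eq_or_ne i 0 with rfl | hi
    · simp
    · rw [if_neg hi, sub_zero]; exact norm_pow_div_factorial_le hi
  have hr : X ^ n ∣ e - g := by
    rw [X_pow_dvd_iff]
    intro m hm
    rw [map_sub, hgc, if_pos hm, sub_self]
  obtain ⟨r, hr⟩ := hr
  have hr0 : constantCoeff r = coeff n e := by
    have := congrArg (coeff n) hr
    rw [map_sub, hgc, if_neg (lt_irrefl n), sub_zero] at this
    rw [this, ← coeff_zero_eq_constantCoeff_apply]
    simpa using (coeff_X_pow_mul r n 0).symm
  have hg0 : constantCoeff g = 1 := by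
    rw [← coeff_zero_eq_constantCoeff_apply, hgc, if_pos hn, coeff_zero_eq_constantCoeff_apply]
    exact constantCoeff_artinHasse
  -- With `e = g + T^n r`, the unknown `e_n = r(0)` enters `e^p` in degree `n` only through the
  -- linear term `p g^(p-1) T^n r`, where `g(0) = 1`.
  have hpow : coeff n (e ^ p) = coeff n (g ^ p) + p * coeff n e := by
    obtain ⟨k, hk⟩ := Polynomial.powAddExpansion g (X ^ n * r) p
    have h1 : e ^ p = g ^ p + X ^ n * ((p : PowerSeries ℚ_[p]) * g ^ (p - 1) * r + k * X ^ n * r ^ 2) := by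
      rw [show e = g + X ^ n * r by rw [← hr]; ring, hk]; ring
    have h2 := coeff_X_pow_mul ((p : PowerSeries ℚ_[p]) * g ^ (p - 1) * r + k * X ^ n * r ^ 2) n 0
    rw [zero_add] at h2
    rw [h1, map_add, h2, coeff_zero_eq_constantCoeff_apply]
    simp [hg0, hr0, hn.ne']
  -- Up to degree `n`, `e(T^p)` only involves coefficients of `e` of index at most `n / p < n`,
  -- which `g` retains.
  have hdil : coeff n (dilate 1 p e * h) = coeff n (dilate 1 p g * h) := by
    rw [coeff_mul, coeff_mul]
    refine Finset.sum_congr rfl fun x hx => ?_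
    have hx := Finset.HasAntidiagonal.mem_antidiagonal.1 hx
    have hlt : x.1 / p < n := (Nat.div_le_div_right (show x.1 ≤ n by omega)).trans_lt
      (Nat.div_lt_self hn hp.out.one_lt)
    rw [coeff_dilate _ hp0, coeff_dilate _ hp0, hgc, if_pos hlt]
  -- Both `h - 1` and `g^p - g(T^p)` are divisible by `p`, so `p e_n` is divisible by `p` and `e_n`
  -- is integral.
  have key : p * coeff n e
      = coeff n (dilate 1 p g * (h - 1) - (g ^ p - dilate 1 p g)) := by
    have h1 := congrArg (coeff n) (artinHasse_pow_prime (p := p) (F := ℚ_[p]))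
    rw [← he, ← hh, hpow, hdil] at h1
    rw [eq_sub_of_add_eq' h1, ← map_sub]
    congr 1; ring
  have hb := ((hd1.mul_one_left hexp (norm_nonneg _) zero_le_one).sub hg1.pow_prime_sub) n
  rw [← key, norm_mul, one_pow] at hb
  exact le_of_mul_le_mul_left hb (norm_pos_iff.2 hp1)

/-- Integrality of the Artin–Hasse exponential over an extension of `ℚ_p`. -/
theorem growthBound_artinHasse {L : Type*} [NormedField L] [CharZero L] (φ : ℚ_[p] →+* L)
    (hφ : ∀ x, ‖φ x‖ = ‖x‖) : GrowthBound 1 1 (artinHasse p L) := fun i => by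
  rw [← map_artinHasse φ, coeff_map, hφ]
  exact growthBound_artinHasse_padic i

end ArtinHasse

/-! ### Expansions in terms of `e(u_n T^n)` -/

section Product

variable {F : Type*} [Field F]

theorem constantCoeff_prod_dilate {e : PowerSeries F} (he : constantCoeff e = 1) (u : ℕ → F)
    (D : ℕ) : constantCoeff (∏ n ∈ Finset.Icc 1 D, dilate (u n) n e) = 1 := by
  rw [map_prod]
  refine Finset.prod_eq_one fun n hn => ?_
  rw [constantCoeff_dilate _ (by have := Finset.mem_Icc.1 hn; omega), he]

/-- Since `e(uT^n) = 1 + u e_1 T^n + …`, the new factor changes nothing below degree `n`. This is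
the unitriangularity behind the comparison of coefficients with coordinates. -/
theorem coeff_mul_dilate {e g : PowerSeries F} (he : constantCoeff e = 1)
    (hg : constantCoeff g = 1) (u : F) {n m : ℕ} (hn : n ≠ 0) (hm : m ≤ n) :
    coeff m (g * dilate u n e) = coeff m g + if m = n then u * coeff 1 e else 0 := by
  have hd : X ^ n ∣ dilate u n e - 1 := by
    rw [X_pow_dvd_iff]
    intro i hi
    rw [map_sub, coeff_dilate _ hn, coeff_one]
    rcases Nat.eq_zero_or_pos i with rfl | h0
    · simp [he]
    · rw [if_neg (fun h => (Nat.le_of_dvd h0 h).not_gt hi), if_neg h0.ne', sub_zero]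
  obtain ⟨r, hr⟩ := hd
  have hr0 : constantCoeff r = u * coeff 1 e := by
    have h1 := congrArg (coeff n) hr
    have h2 := coeff_X_pow_mul r n 0
    rw [zero_add] at h2
    rw [h2, map_sub, coeff_dilate _ hn, if_pos dvd_rfl, Nat.div_self (Nat.pos_of_ne_zero hn),
      coeff_one, if_neg hn] at h1
    simpa using h1.symm
  rw [eq_add_of_sub_eq' hr, mul_add, mul_one, map_add, mul_left_comm, coeff_X_pow_mul']
  rcases hm.lt_or_eq with h | h
  · rw [if_neg h.not_ge, if_neg h.ne]
  · subst h; simp [hg, hr0]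

end Product

section Product

variable {L : Type*} [NormedField L] [IsUltrametricDist L]

/-- For an integral series `e = 1 + e_1 T + …` with `|e_1| = 1`, the coefficients of
`∏ e(u_n T^n)` and the `u_n` satisfy the same isobaric bounds. -/
theorem forall_coeff_prod_dilate_le_iff {e : PowerSeries L} (he : GrowthBound 1 1 e)
    (he0 : constantCoeff e = 1) (he1 : ‖coeff 1 e‖ = 1) (u : ℕ → L) {r : ℝ} (hr : 0 ≤ r) (D : ℕ) :
    (∀ i ∈ Finset.Icc 1 D, ‖coeff i (∏ n ∈ Finset.Icc 1 D, dilate (u n) n e)‖ ≤ r ^ i)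
      ↔ ∀ i ∈ Finset.Icc 1 D, ‖u i‖ ≤ r ^ i := by
  have hprod : ∀ D, (∀ i ∈ Finset.Icc 1 D, ‖u i‖ ≤ r ^ i) →
      GrowthBound 1 r (∏ n ∈ Finset.Icc 1 D, dilate (u n) n e) := fun D h =>
    GrowthBound.prod hr fun n hn => he.dilate zero_le_one
      (by have := Finset.mem_Icc.1 hn; omega) hr (h n hn)
  refine ⟨fun h => ?_, fun h i _ => by simpa using hprod D h i⟩
  induction D with
  | zero => simp
  | succ D ih =>
    have hc : ∀ m ≤ D + 1, coeff m (∏ n ∈ Finset.Icc 1 (D + 1), dilate (u n) n e)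
        = coeff m (∏ n ∈ Finset.Icc 1 D, dilate (u n) n e)
          + if m = D + 1 then u (D + 1) * coeff 1 e else 0 := fun m hm => by
      rw [Finset.prod_Icc_succ_top (by omega), coeff_mul_dilate he0
        (constantCoeff_prod_dilate he0 u D) _ (by omega) hm]
    have ih' := ih fun i hi => by
      have hi' := Finset.mem_Icc.1 hi
      have := h i (Finset.mem_Icc.2 ⟨hi'.1, by omega⟩)
      rwa [hc i (by omega), if_neg (by omega), add_zero] at this
    intro i hi
    have hi' := Finset.mem_Icc.1 hi
    rcases hi'.2.lt_or_eq with hlt | rfl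
    · exact ih' i (Finset.mem_Icc.2 ⟨hi'.1, by omega⟩)
    · have h1 := h (D + 1) hi
      have h2 := hprod D ih' (D + 1)
      rw [one_mul] at h2
      have h3 : ‖u (D + 1)‖ = ‖u (D + 1) * coeff 1 e‖ := by rw [norm_mul, he1, mul_one]
      have h4 := hc (D + 1) le_rfl
      rw [if_pos rfl] at h4
      -- Up to the unit `e_1`, the last coordinate is the difference of the top coefficients of the
      -- full and the shorter product, both bounded by `r^(D+1)`.
      rw [h3, eq_sub_of_add_eq' h4.symm, sub_eq_add_neg]
      refine (IsUltrametricDist.norm_add_le_max _ _).trans (max_le h1 ?_)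
      rwa [norm_neg]

omit [IsUltrametricDist L] in
theorem dilate_one_sub_X (u : L) {n : ℕ} (hn : n ≠ 0) :
    dilate u n (1 - X) = 1 - C u * X ^ n := by
  ext i
  rw [coeff_dilate _ hn, map_sub, map_sub, coeff_C_mul, coeff_X_pow, coeff_one, coeff_one, coeff_X]
  by_cases hd : n ∣ i
  · obtain ⟨k, rfl⟩ := hd
    rw [if_pos (dvd_mul_right n k), Nat.mul_div_cancel_left k (Nat.pos_of_ne_zero hn)]
    rcases k with _ | _ | k
    · simp [hn.symm]
    · simp [hn]
    · have : n * (k + 1 + 1) ≠ n := fun h => by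
        have := Nat.eq_of_mul_eq_mul_left (Nat.pos_of_ne_zero hn) (h.trans (mul_one n).symm)
        omega
      simp [hn, this]
  · have h0 : i ≠ 0 := fun h => hd (h ▸ dvd_zero n)
    have h1 : i ≠ n := fun h => hd (h ▸ dvd_rfl)
    simp [hd, h0, h1]

/-- The Witt coordinates satisfy the same isobaric bounds as the coefficients. -/
theorem forall_coeff_le_iff_wittCoord {f : PowerSeries L} (hf : constantCoeff f = 1) {r : ℝ}
    (hr : 0 ≤ r) (D : ℕ) : (∀ i ∈ Finset.Icc 1 D, ‖coeff i f‖ ≤ r ^ i)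
      ↔ ∀ i ∈ Finset.Icc 1 D, ‖wittCoord f i‖ ≤ r ^ i := by
  have he : GrowthBound 1 1 (1 - X : PowerSeries L) := fun i => by
    rcases i with _ | _ | i
    · simp
    · simp
    · simp [coeff_one, coeff_X]
  rw [← forall_coeff_prod_dilate_le_iff he (by simp) (by simp [coeff_one]) (wittCoord f) hr D]
  refine forall₂_congr fun i hi => ?_
  rw [Finset.prod_congr rfl fun n hn => dilate_one_sub_X _
    (by have := Finset.mem_Icc.1 hn; omega : n ≠ 0), prod_wittCoord f hf D i (Finset.mem_Icc.1 hi).2]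

/-- Every series agrees modulo `T^{D+1}` (up to the constant term) with `∑ e(v_n T^n)` if
`e = T + …`. -/
theorem exists_coeff_sum_dilate_eq {F : Type*} [Field F] {e : PowerSeries F}
    (he1 : coeff 1 e = 1) (f : PowerSeries F) (D : ℕ) :
    ∃ v : ℕ → F, ∀ m, 1 ≤ m → m ≤ D →
      coeff m (∑ n ∈ Finset.Icc 1 D, dilate (v n) n e) = coeff m f := by
  induction D with
  | zero => exact ⟨0, fun m h1 h2 => by omega⟩
  | succ D ih =>
    obtain ⟨v, hv⟩ := ih
    set c := coeff (D + 1) f - coeff (D + 1) (∑ n ∈ Finset.Icc 1 D, dilate (v n) n e) with hc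
    -- Because `e = T + …`, the term `e(cT^(D+1))` corrects degree `D + 1` by exactly `c` and leaves
    -- the lower degrees alone.
    refine ⟨Function.update v (D + 1) c, fun m h1 h2 => ?_⟩
    rw [Finset.sum_Icc_succ_top (by omega), Function.update_self, map_add,
      coeff_dilate _ (by omega : D + 1 ≠ 0),
      Finset.sum_congr rfl fun n hn => by rw [Function.update_of_ne (by
        have := Finset.mem_Icc.1 hn; omega : n ≠ D + 1)]]
    rcases h2.lt_or_eq with h | rfl
    · rw [hv m h1 (by omega), if_neg (fun hd => (Nat.le_of_dvd (by omega) hd).not_gt h), add_zero]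
    · rw [if_pos dvd_rfl, Nat.div_self (by omega), he1, hc]
      ring

end Product

/-! ### Distances from `1` of roots of unity of `p`-power order -/

section RootsOfUnity

variable {L : Type*} [NormedField L] [IsUltrametricDist L]

theorem norm_sub_le_max (x y : L) : ‖x - y‖ ≤ max ‖x‖ ‖y‖ := by
  simpa [sub_eq_add_neg] using IsUltrametricDist.norm_add_le_max x (-y)

theorem exists_add_one_pow_prime {p : ℕ} (hp : p.Prime) {x : L} (hx : ‖x‖ ≤ 1) :
    ∃ s : L, ‖s‖ ≤ 1 ∧ (x + 1) ^ p = x ^ p + 1 + p * x * s := by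
  obtain ⟨r, hr⟩ := exists_add_pow_prime_eq hp (Polynomial.X : Polynomial ℤ) 1
  refine ⟨Polynomial.aeval x r, ?_, ?_⟩
  · rw [Polynomial.aeval_eq_sum_range]
    refine IsUltrametricDist.norm_sum_le_of_forall_le_of_nonneg zero_le_one fun i _ => ?_
    rw [zsmul_eq_mul, norm_mul, norm_pow]
    exact mul_le_one₀ (IsUltrametricDist.norm_intCast_le_one L _) (by positivity)
      (pow_le_one₀ (norm_nonneg x) hx)
  · simpa using congrArg (Polynomial.aeval x) hr

theorem norm_pow_sub_one_le {z : L} (hz : ‖z‖ ≤ 1) (k : ℕ) : ‖z ^ k - 1‖ ≤ ‖z - 1‖ := by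
  induction k with
  | zero => simp
  | succ k ih =>
    rw [show z ^ (k + 1) - 1 = z * (z ^ k - 1) + (z - 1) by ring]
    refine (IsUltrametricDist.norm_add_le_max _ _).trans (max_le ?_ le_rfl)
    rw [norm_mul]
    exact (mul_le_of_le_one_left (norm_nonneg _) hz).trans ih

theorem norm_pow_sub_one_sub_le {z : L} (hz : ‖z‖ ≤ 1) (k : ℕ) :
    ‖z ^ k - 1 - k * (z - 1)‖ ≤ ‖z - 1‖ ^ 2 := by
  induction k with
  | zero => simp
  | succ k ih =>
    rw [show z ^ (k + 1) - 1 - ((k + 1 : ℕ) : L) * (z - 1)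
      = z * (z ^ k - 1 - k * (z - 1)) + k * (z - 1) ^ 2 by push_cast; ring]
    refine (IsUltrametricDist.norm_add_le_max _ _).trans (max_le ?_ ?_)
    · rw [norm_mul]
      exact (mul_le_of_le_one_left (norm_nonneg _) hz).trans ih
    · rw [norm_mul, norm_pow]
      exact mul_le_of_le_one_left (by positivity) (IsUltrametricDist.norm_natCast_le_one L k)

/-- Modulo `p`, `(z - 1)^p` is `z^p - 1`, so the claim for `z` follows from the claim for `z^p`. -/
theorem norm_sub_one_lt_one {p : ℕ} (hp : p.Prime) (hpL : ‖(p : L)‖ < 1) {z : L} {k : ℕ}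
    (hz : z ^ p ^ k = 1) : ‖z - 1‖ < 1 := by
  induction k generalizing z with
  | zero => simp_all
  | succ k ih =>
    have hz1 : ‖z‖ = 1 := by
      have h := congrArg norm hz
      rw [norm_pow, norm_one] at h
      exact (pow_eq_one_iff_of_nonneg (norm_nonneg z) (pow_ne_zero _ hp.ne_zero)).1 h
    have hx : ‖z - 1‖ ≤ 1 := (norm_sub_le_max _ _).trans (by simp [hz1])
    obtain ⟨s, hs, h⟩ := exists_add_one_pow_prime hp hx
    have h1 : ‖z ^ p - 1‖ < 1 := ih (by rw [← pow_mul, ← pow_succ', hz])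
    have h2 : (z - 1) ^ p = (z ^ p - 1) - p * (z - 1) * s := by
      rw [sub_add_cancel] at h; rw [h]; ring
    have h3 : ‖(z - 1) ^ p‖ < 1 := by
      rw [h2]
      refine (norm_sub_le_max _ _).trans_lt (max_lt h1 ?_)
      rw [norm_mul, norm_mul]
      have : ‖z - 1‖ * ‖s‖ ≤ 1 := mul_le_one₀ hx (norm_nonneg _) hs
      rw [mul_assoc]
      exact (mul_le_of_le_one_right (norm_nonneg _) this).trans_lt hpL
    rw [norm_pow] at h3
    exact lt_of_not_ge fun h => (one_le_pow₀ h).not_gt h3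

theorem norm_pow_prime_sub_one_lt {p : ℕ} (hp : p.Prime) (hpL : ‖(p : L)‖ < 1) {z : L}
    (hz : ‖z - 1‖ < 1) (hz1 : z ≠ 1) : ‖z ^ p - 1‖ < ‖z - 1‖ := by
  obtain ⟨s, hs, h⟩ := exists_add_one_pow_prime hp hz.le
  rw [sub_add_cancel] at h
  -- As `p ≥ 2`, a positive power of `z - 1` remains after one factor is extracted, and the cofactor
  -- has norm less than `1`.
  obtain ⟨q, hq⟩ : ∃ q, p = q + 1 + 1 := ⟨p - 2, by have := hp.two_le; omega⟩
  have h1 : z ^ p - 1 = (z - 1) * ((z - 1) ^ (q + 1) + p * s) := by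
    rw [h, show (z - 1) ^ p = (z - 1) ^ (q + 1 + 1) by rw [← hq]]; ring
  rw [h1, norm_mul]
  refine mul_lt_of_lt_one_right (norm_pos_iff.2 (sub_ne_zero.2 hz1)) ?_
  refine (IsUltrametricDist.norm_add_le_max _ _).trans_lt (max_lt ?_ ?_)
  · rw [norm_pow]; exact pow_lt_one₀ (norm_nonneg _) hz (by omega)
  · rw [norm_mul]; exact (mul_le_of_le_one_right (norm_nonneg _) hs).trans_lt hpL

end RootsOfUnity

/-! ### Arithmetic of the indices `d_n` -/

section Index

variable {p D : ℕ}

theorem dIndex_antitone {m n : ℕ} (hm : 1 ≤ m) (h : m ≤ n) : dIndex p D n ≤ dIndex p D m :=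
  Nat.log_mono_right (Nat.div_le_div_left h hm)

/-- The truncated subtraction is right even when `m p^i > D`: the quotient is then `0`, and so is
its logarithm. -/
theorem dIndex_mul_pow (m i : ℕ) : dIndex p D (m * p ^ i) = dIndex p D m - i := by
  rw [dIndex, ← Nat.div_div_eq_div_mul, Nat.log_div_base_pow, dIndex]

theorem le_dIndex (hp : 1 < p) {m i : ℕ} (hm : 1 ≤ m) (h : m * p ^ i ≤ D) : i ≤ dIndex p D m :=
  Nat.le_log_of_pow_le hp ((Nat.le_div_iff_mul_le hm).2 (by rwa [mul_comm]))

theorem dIndex_lt {m i : ℕ} (hm : 1 ≤ m) (hmD : m ≤ D) (h : D < m * p ^ i) :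
    dIndex p D m < i :=
  Nat.log_lt_of_lt_pow (Nat.div_pos hmD hm).ne' ((Nat.div_lt_iff_lt_mul hm).2 (by rwa [mul_comm]))

end Index

/-! ### Factorization of `exp(P)` by Artin–Hasse exponentials -/

section Factorization

variable {p D : ℕ}

/-- Passing from `m` to `m p^i` lowers `d_m` by `i`, which raises the exponent of `p` above `ζ` by
`i`. The hypothesis on `i` rules out truncation. -/
theorem zeta_pow {M : Type*} [Monoid M] (ζ : M) {m i : ℕ} (hm : 1 ≤ m)
    (hi : i ≤ dIndex p D m) :
    (ζ ^ p ^ (dIndex p D 1 - dIndex p D m)) ^ p ^ i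
      = ζ ^ p ^ (dIndex p D 1 - dIndex p D (m * p ^ i)) := by
  have h1 := dIndex_antitone (p := p) (D := D) le_rfl hm
  rw [dIndex_mul_pow, ← pow_mul, ← pow_add]
  congr 2
  omega

theorem zeta_pow_eq_one {M : Type*} [CommMonoid M] {ζ : M}
    (hζ : IsPrimitiveRoot ζ (p ^ (dIndex p D 1 + 1))) {m i : ℕ} (hm : 1 ≤ m)
    (hi : dIndex p D m < i) :
    (ζ ^ p ^ (dIndex p D 1 - dIndex p D m)) ^ p ^ i = 1 := by
  have h1 := dIndex_antitone (p := p) (D := D) le_rfl hm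
  rw [← pow_mul, ← pow_add, hζ.pow_eq_one_iff_dvd]
  exact pow_dvd_pow p (by omega)

theorem zeta_ne_one (hp : 1 < p) {M : Type*} [CommMonoid M] {ζ : M}
    (hζ : IsPrimitiveRoot ζ (p ^ (dIndex p D 1 + 1))) (m : ℕ) :
    ζ ^ p ^ (dIndex p D 1 - dIndex p D m) ≠ 1 := by
  rw [Ne, hζ.pow_eq_one_iff_dvd, Nat.pow_dvd_pow_iff_le_right hp]
  omega

variable [hp : Fact p.Prime] {K L : Type*} [Field K] [Field L] [CharZero L] [Algebra K L]

omit hp [CharZero L] in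
theorem coeff_tildePoly (ζ : L) (P : Polynomial K) {n : ℕ} (hn : n ∈ Finset.Icc 1 D) :
    (tildePoly p D ζ P).coeff n
      = algebraMap K L (P.coeff n) / (ζ ^ p ^ (dIndex p D 1 - dIndex p D n) - 1) := by
  rw [tildePoly, Polynomial.finsetSum_coeff, Finset.sum_eq_single n]
  · simp
  · intro m _ hm; rw [Polynomial.coeff_monomial, if_neg hm]
  · exact fun h => absurd hn h

omit hp [CharZero L] in
theorem coeff_zero_tildePoly (ζ : L) (P : Polynomial K) :
    (tildePoly p D ζ P).coeff 0 = 0 := by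
  rw [tildePoly, Polynomial.finsetSum_coeff]
  refine Finset.sum_eq_zero fun m hm => ?_
  rw [Polynomial.coeff_monomial, if_neg (by have := Finset.mem_Icc.1 hm; omega)]

omit [CharZero L] in
/-- Comparison of the dilated logarithms of the two sides of
`map_expSeries_mul_prod_dilate`. -/
theorem map_add_sum_dilate_log {ζ : L} (hζ : IsPrimitiveRoot ζ (p ^ (dIndex p D 1 + 1)))
    {P : Polynomial K} (hP0 : P.coeff 0 = 0) (hPD : P.natDegree ≤ D) {v : ℕ → L}
    (hv : ∀ m, 1 ≤ m → m ≤ D →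
      coeff m (∑ n ∈ Finset.Icc 1 D, dilate (v n) n (artinHasseLog p L))
        = coeff m (tildePoly p D ζ P : PowerSeries L)) :
    PowerSeries.map (algebraMap K L) (P : PowerSeries K)
        + ∑ m ∈ Finset.Icc 1 D, dilate (v m) m (artinHasseLog p L)
      = ∑ m ∈ Finset.Icc 1 D,
        dilate (ζ ^ p ^ (dIndex p D 1 - dIndex p D m) * v m) m (artinHasseLog p L) := by
  ext n
  have h0 : coeff 0 (artinHasseLog p L) = 0 := by
    rw [coeff_zero_eq_constantCoeff_apply]; exact constantCoeff_artinHasseLog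
  rw [map_add, coeff_map, Polynomial.coeff_coe]
  rcases Nat.eq_zero_or_pos n with rfl | hn
  · rw [hP0, map_zero, zero_add, map_sum, map_sum]
    refine Finset.sum_congr rfl fun m hm => ?_
    have hm0 : m ≠ 0 := by have := Finset.mem_Icc.1 hm; omega
    rw [coeff_dilate _ hm0, coeff_dilate _ hm0]
    simp [h0]
  -- The multiplier does not depend on `m`, so it comes out of the sum over `m`; beyond degree `D`
  -- it is `1` and the two sums cancel.
  have hterm : ∀ m ∈ Finset.Icc 1 D,
      coeff n (dilate (ζ ^ p ^ (dIndex p D 1 - dIndex p D m) * v m) m (artinHasseLog p L))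
        = (if n ≤ D then ζ ^ p ^ (dIndex p D 1 - dIndex p D n) else 1)
          * coeff n (dilate (v m) m (artinHasseLog p L)) := by
    intro m hm
    obtain ⟨hm1, hmD⟩ := Finset.mem_Icc.1 hm
    have hm0 : m ≠ 0 := by omega
    rw [coeff_dilate _ hm0, coeff_dilate _ hm0]
    split_ifs with hd hnD hnD
    · obtain ⟨k, rfl⟩ := hd
      rw [Nat.mul_div_cancel_left k hm1]
      by_cases hk : ∃ i, k = p ^ i
      · obtain ⟨i, rfl⟩ := hk
        rw [mul_pow, zeta_pow ζ hm1 (le_dIndex hp.out.one_lt hm1 hnD), mul_assoc]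
      · push Not at hk
        rw [coeff_artinHasseLog_ne hk]; simp
    · obtain ⟨k, rfl⟩ := hd
      rw [Nat.mul_div_cancel_left k hm1]
      by_cases hk : ∃ i, k = p ^ i
      · obtain ⟨i, rfl⟩ := hk
        rw [mul_pow, zeta_pow_eq_one hζ hm1 (dIndex_lt hm1 hmD (by omega))]
        ring
      · push Not at hk
        rw [coeff_artinHasseLog_ne hk]; simp
    · simp
    · simp
  rw [map_sum, map_sum, Finset.sum_congr rfl hterm, ← Finset.mul_sum]
  split_ifs with hnD
  · have h1 := hv n hn hnD
    rw [map_sum, Polynomial.coeff_coe, coeff_tildePoly ζ P (Finset.mem_Icc.2 ⟨hn, hnD⟩),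
      eq_div_iff (sub_ne_zero.2 (zeta_ne_one hp.out.one_lt hζ n))] at h1
    rw [← h1]; ring
  · rw [Polynomial.coeff_eq_zero_of_natDegree_lt (by omega), map_zero]; ring

omit hp [CharZero L] in
theorem constantCoeff_dilate_log (u : L) {n : ℕ} (hn : n ∈ Finset.Icc 1 D) :
    constantCoeff (dilate u n (artinHasseLog p L)) = 0 := by
  rw [constantCoeff_dilate _ (by have := Finset.mem_Icc.1 hn; omega), constantCoeff_artinHasseLog]

omit hp in
theorem expSeries_sum_dilate (u : ℕ → L) (D : ℕ) :
    expSeries (∑ n ∈ Finset.Icc 1 D, dilate (u n) n (artinHasseLog p L))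
      = ∏ n ∈ Finset.Icc 1 D, dilate (u n) n (artinHasse p L) := by
  rw [expSeries_sum _ _ fun n hn => constantCoeff_dilate_log _ hn]
  refine Finset.prod_congr rfl fun n hn => ?_
  rw [artinHasse, dilate_expSeries _ (by have := Finset.mem_Icc.1 hn; omega)
    constantCoeff_artinHasseLog]

/-- The factorization of `exp(P)` into dilated quotients of Artin–Hasse exponentials. -/
theorem map_expSeries_mul_prod_dilate [CharZero K] {ζ : L}
    (hζ : IsPrimitiveRoot ζ (p ^ (dIndex p D 1 + 1)))
    {P : Polynomial K} (hP0 : P.coeff 0 = 0) (hPD : P.natDegree ≤ D) {v : ℕ → L}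
    (hv : ∀ m, 1 ≤ m → m ≤ D →
      coeff m (∑ n ∈ Finset.Icc 1 D, dilate (v n) n (artinHasseLog p L))
        = coeff m (tildePoly p D ζ P : PowerSeries L)) :
    PowerSeries.map (algebraMap K L) (expSeries (P : PowerSeries K))
        * ∏ m ∈ Finset.Icc 1 D, dilate (v m) m (artinHasse p L)
      = ∏ m ∈ Finset.Icc 1 D,
        dilate (ζ ^ p ^ (dIndex p D 1 - dIndex p D m) * v m) m (artinHasse p L) := by
  have hP : constantCoeff (P : PowerSeries K) = 0 := by
    rw [← coeff_zero_eq_constantCoeff_apply, Polynomial.coeff_coe, hP0]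
  rw [map_expSeries _ hP, ← expSeries_sum_dilate, ← expSeries_sum_dilate, ← expSeries_add,
    map_add_sum_dilate_log hζ hP0 hPD hv]
  · rw [← coeff_zero_eq_constantCoeff_apply, coeff_map, coeff_zero_eq_constantCoeff_apply, hP,
      map_zero]
  · rw [map_sum]; exact Finset.sum_eq_zero fun n hn => constantCoeff_dilate_log _ hn

omit hp in
theorem coeff_tildeExp_eq {ζ : L} {P : Polynomial K} {v : ℕ → L}
    (hv : ∀ m, 1 ≤ m → m ≤ D →
      coeff m (∑ n ∈ Finset.Icc 1 D, dilate (v n) n (artinHasseLog p L))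
        = coeff m (tildePoly p D ζ P : PowerSeries L)) {i : ℕ} (hi : i ≤ D) :
    (tildeExp p D ζ P).coeff i
      = coeff i (∏ n ∈ Finset.Icc 1 D, dilate (v n) n (artinHasse p L)) := by
  rw [tildeExp, coeff_trunc, if_pos (by omega), ← expSeries_sum_dilate]
  refine coeff_expSeries_congr ?_ ?_ (fun m h1 h2 => (hv m h1 h2).symm) i hi
  · rw [← coeff_zero_eq_constantCoeff_apply, Polynomial.coeff_coe, coeff_zero_tildePoly]
  · rw [map_sum]; exact Finset.sum_eq_zero fun n hn => constantCoeff_dilate_log _ hn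

end Factorization

/-! ### First-order expansion of `E(zvT^m) / E(vT^m)` at `z = 1` -/

section Quotient

variable (p : ℕ) (L : Type*) [NormedField L] [CharZero L]

/-- The series `T + T^p + T^(p^2) + …`, the logarithmic derivative `T E'/E` of the Artin–Hasse
exponential `E`. -/
noncomputable def logDerivArtinHasse : PowerSeries L := X * d⁄dX L (artinHasseLog p L)

variable {p L}

theorem coeff_logDerivArtinHasse (k : ℕ) :
    coeff k (logDerivArtinHasse p L) = if k ≠ 0 ∧ k = p ^ Nat.log p k then 1 else 0 := by
  rcases k with _ | k
  · simp [logDerivArtinHasse]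
  · rw [logDerivArtinHasse, coeff_succ_X_mul, coeff_derivative, artinHasseLog, coeff_mk]
    have : ((k + 1 : ℕ) : L) ≠ 0 := by exact_mod_cast Nat.succ_ne_zero k
    split_ifs with h1 h2 h2
    · rw [← Nat.cast_succ, inv_mul_cancel₀ this]
    · exact absurd ⟨by omega, h1⟩ h2
    · exact absurd h2.2 h1
    · simp

theorem growthBound_logDerivArtinHasse : GrowthBound 1 1 (logDerivArtinHasse p L) := fun k => by
  rw [coeff_logDerivArtinHasse]
  split_ifs <;> simp

theorem coeff_logDeriv_mul_artinHasse (k : ℕ) :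
    coeff k (logDerivArtinHasse p L * artinHasse p L) = k * coeff k (artinHasse p L) := by
  rw [logDerivArtinHasse, mul_assoc, mul_comm (d⁄dX L _), artinHasse,
    ← derivative_expSeries constantCoeff_artinHasseLog]
  rcases k with _ | k
  · simp
  · rw [coeff_succ_X_mul, coeff_derivative, Nat.cast_succ, mul_comm]

variable (p) in
/-- The quotient `E(z v T^m) / E(v T^m)` of Artin–Hasse exponentials. -/
noncomputable def artinHasseQuot (z v : L) (m : ℕ) : PowerSeries L :=
  dilate (z * v) m (artinHasse p L) * (dilate v m (artinHasse p L))⁻¹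

theorem constantCoeff_dilate_artinHasse_ne_zero (v : L) {m : ℕ} (hm : m ≠ 0) :
    constantCoeff (dilate v m (artinHasse p L)) ≠ 0 := by
  rw [constantCoeff_dilate _ hm, constantCoeff_artinHasse]; exact one_ne_zero

theorem constantCoeff_artinHasseQuot (z v : L) {m : ℕ} (hm : m ≠ 0) :
    constantCoeff (artinHasseQuot p z v m) = 1 := by
  rw [artinHasseQuot, map_mul, constantCoeff_inv, constantCoeff_dilate _ hm,
    constantCoeff_dilate _ hm, constantCoeff_artinHasse, inv_one, mul_one]

variable [IsUltrametricDist L] {z v : L} {m : ℕ} {r : ℝ}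

theorem growthBound_dilate_inv (hE : GrowthBound 1 1 (artinHasse p L)) (hm : m ≠ 0) (hr : 0 ≤ r)
    (hv : ‖v‖ ≤ r ^ m) : GrowthBound 1 r (dilate v m (artinHasse p L))⁻¹ :=
  (hE.dilate zero_le_one hm hr hv).inv hr
    (by rw [constantCoeff_dilate _ hm, constantCoeff_artinHasse])

theorem growthBound_artinHasseQuot (hE : GrowthBound 1 1 (artinHasse p L)) (hm : m ≠ 0)
    (hr : 0 ≤ r) (hz : ‖z‖ ≤ 1) (hv : ‖v‖ ≤ r ^ m) : GrowthBound 1 r (artinHasseQuot p z v m) := by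
  refine GrowthBound.mul_one_left (hE.dilate zero_le_one hm hr ?_)
    (growthBound_dilate_inv hE hm hr hv) zero_le_one hr
  rw [norm_mul]
  exact (mul_le_of_le_one_left (norm_nonneg _) hz).trans hv

omit [IsUltrametricDist L] in
theorem artinHasseQuot_sub_one (hm : m ≠ 0) : artinHasseQuot p z v m - 1
    = dilate v m (rescale z (artinHasse p L) - artinHasse p L)
      * (dilate v m (artinHasse p L))⁻¹ := by
  have h : dilate v m (rescale z (artinHasse p L) - artinHasse p L)
      = dilate (z * v) m (artinHasse p L) - dilate v m (artinHasse p L) := by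
    ext i
    rw [map_sub, coeff_dilate _ hm, coeff_dilate _ hm, coeff_dilate _ hm, map_sub, coeff_rescale]
    split_ifs
    · ring
    · ring
  rw [h, sub_mul, PowerSeries.mul_inv_cancel _ (constantCoeff_dilate_artinHasse_ne_zero v hm),
    artinHasseQuot]

theorem growthBound_artinHasseQuot_sub_one (hE : GrowthBound 1 1 (artinHasse p L)) (hm : m ≠ 0)
    (hr : 0 ≤ r) (hz : ‖z‖ ≤ 1) (hv : ‖v‖ ≤ r ^ m) :
    GrowthBound ‖z - 1‖ r (artinHasseQuot p z v m - 1) := by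
  rw [artinHasseQuot_sub_one hm, ← mul_one ‖z - 1‖]
  refine GrowthBound.mul (GrowthBound.dilate (fun k => ?_) (norm_nonneg _) hm hr hv)
    (growthBound_dilate_inv hE hm hr hv) (norm_nonneg _) zero_le_one hr
  rw [map_sub, coeff_rescale, ← sub_one_mul, norm_mul, one_pow]
  exact mul_le_mul (norm_pow_sub_one_le hz k) (by simpa using hE k) (norm_nonneg _)
    (norm_nonneg _)

/-- After multiplication by `E`, and with `vT^m` replaced by `T`, the `k`-th coefficient is `(z^k -
1 - k(z - 1)) E_k`, because `T E' = N E` with `N = logDerivArtinHasse`. The first factor is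
quadratic in `z - 1`. -/
theorem growthBound_artinHasseQuot_sub_linear (hE : GrowthBound 1 1 (artinHasse p L)) (hm : m ≠ 0)
    (hr : 0 ≤ r) (hz : ‖z‖ ≤ 1) (hv : ‖v‖ ≤ r ^ m) :
    GrowthBound (‖z - 1‖ ^ 2) r (artinHasseQuot p z v m - 1
      - C (z - 1) * dilate v m (logDerivArtinHasse p L)) := by
  have h1 : artinHasseQuot p z v m - 1 - C (z - 1) * dilate v m (logDerivArtinHasse p L)
      = dilate v m (rescale z (artinHasse p L) - artinHasse p L
          - C (z - 1) * (logDerivArtinHasse p L * artinHasse p L))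
        * (dilate v m (artinHasse p L))⁻¹ := by
    have h2 : dilate v m (rescale z (artinHasse p L) - artinHasse p L
          - C (z - 1) * (logDerivArtinHasse p L * artinHasse p L))
        = dilate v m (rescale z (artinHasse p L) - artinHasse p L)
          - C (z - 1) * (dilate v m (logDerivArtinHasse p L) * dilate v m (artinHasse p L)) := by
      rw [← dilate_mul _ hm]
      generalize z - 1 = w
      ext i
      rw [map_sub, coeff_C_mul, coeff_dilate _ hm, coeff_dilate _ hm, coeff_dilate _ hm, map_sub,
        coeff_C_mul]
      split_ifs
      · ring
      · ring
    rw [h2, sub_mul, ← artinHasseQuot_sub_one hm, mul_assoc (C (z - 1)), mul_assoc,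
      PowerSeries.mul_inv_cancel _ (constantCoeff_dilate_artinHasse_ne_zero v hm), mul_one]
  rw [h1, ← mul_one (‖z - 1‖ ^ 2)]
  refine GrowthBound.mul (GrowthBound.dilate (fun k => ?_) (by positivity) hm hr hv)
    (growthBound_dilate_inv hE hm hr hv) (by positivity) zero_le_one hr
  rw [map_sub, map_sub, coeff_rescale, coeff_C_mul, coeff_logDeriv_mul_artinHasse,
    show ∀ e : L, z ^ k * e - e - (z - 1) * (k * e) = (z ^ k - 1 - k * (z - 1)) * e by
      intro e; ring, norm_mul, one_pow]
  exact mul_le_mul (norm_pow_sub_one_sub_le hz k) (by simpa using hE k) (norm_nonneg _)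
    (by positivity)

omit [CharZero L] in
/-- First-order expansion of a product of series that are close to `1`. -/
theorem growthBound_prod_sub_linear {ι : Type*} {S : Finset ι} {h N : ι → PowerSeries L} {a : L}
    {c : ℝ} (hr : 0 ≤ r) (hac : ‖a‖ ^ 2 ≤ c) (hca : c ≤ ‖a‖) (ha : ‖a‖ ≤ 1)
    (hN : ∀ i ∈ S, GrowthBound 1 r (N i))
    (hh : ∀ i ∈ S, GrowthBound c r (h i - 1 - C a * N i)) :
    GrowthBound c r (∏ i ∈ S, h i - 1 - C a * ∑ i ∈ S, N i) := by
  classical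
  have hc : 0 ≤ c := (by positivity : 0 ≤ ‖a‖ ^ 2).trans hac
  -- The second bound is carried along to control the cross term `a N_j (∏ h_i - 1)`, which has size
  -- at most `‖a‖ ^ 2 ≤ c`.
  suffices H : GrowthBound c r (∏ i ∈ S, h i - 1 - C a * ∑ i ∈ S, N i) ∧
      GrowthBound ‖a‖ r (∏ i ∈ S, h i - 1) from H.1
  induction S using Finset.induction_on with
  | empty =>
    have h0 : ∀ c : ℝ, 0 ≤ c → GrowthBound c r (0 : PowerSeries L) := fun c hc i => by
      rw [map_zero, norm_zero]; positivity
    simpa using ⟨h0 c hc, h0 ‖a‖ (norm_nonneg a)⟩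
  | insert j S hj ih =>
    obtain ⟨ih1, ih2⟩ := ih (fun i hi => hN i (by simp [hi])) fun i hi => hh i (by simp [hi])
    have hNj := hN j (by simp)
    have hhj := hh j (by simp)
    have hB : GrowthBound 1 r (∏ i ∈ S, h i) := by
      have := (ih2.mono ha hr).add (GrowthBound.one hr)
      rwa [sub_add_cancel] at this
    have haN : GrowthBound ‖a‖ r (C a * N j) := by simpa using hNj.C_mul a
    rw [Finset.prod_insert hj, Finset.sum_insert hj]
    constructor
    · rw [show h j * ∏ i ∈ S, h i - 1 - C a * (N j + ∑ i ∈ S, N i)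
        = (∏ i ∈ S, h i) * (h j - 1 - C a * N j) + (∏ i ∈ S, h i - 1 - C a * ∑ i ∈ S, N i)
          + (C a * N j) * (∏ i ∈ S, h i - 1) by ring]
      refine ((hB.mul_one_left hhj hc hr).add ih1).add ?_
      refine (haN.mul ih2 (norm_nonneg _) (norm_nonneg _) hr).mono ?_ hr
      rwa [← pow_two]
    · rw [show h j * ∏ i ∈ S, h i - 1
        = (∏ i ∈ S, h i) * ((h j - 1 - C a * N j) + C a * N j) + (∏ i ∈ S, h i - 1) by ring]
      exact (hB.mul_one_left ((hhj.mono hca hr).add haN) (norm_nonneg _) hr).add ih2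

end Quotient

/-! ### Lower bound for the growth of the coefficients of `exp(P)` -/

section LowerBound

variable {p D : ℕ} [hp : Fact p.Prime] {L : Type*} [NormedField L] [CharZero L]
  [IsUltrametricDist L]

/-- A finite family with `|v_m| < r^m` satisfies such a bound for some smaller `r`. -/
theorem exists_lt_forall_norm_le_pow {F : Type*} [NormedField F] (T : Finset ℕ) (v : ℕ → F)
    {s r : ℝ} (hs : 0 ≤ s) (hsr : s < r) (h : ∀ m ∈ T, m ≠ 0 ∧ ‖v m‖ < r ^ m) :
    ∃ t, s ≤ t ∧ t < r ∧ ∀ m ∈ T, ‖v m‖ ≤ t ^ m := by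
  induction T using Finset.induction_on with
  | empty => exact ⟨s, le_rfl, hsr, by simp⟩
  | insert a T ha ih =>
    obtain ⟨t, h1, h2, h3⟩ := ih fun m hm => h m (by simp [hm])
    obtain ⟨ha0, har⟩ := h a (by simp)
    have hroot : (‖v a‖ ^ ((a : ℝ)⁻¹)) ^ a = ‖v a‖ := Real.rpow_inv_natCast_pow (norm_nonneg _) ha0
    have h4 : ‖v a‖ ^ ((a : ℝ)⁻¹) < r :=
      lt_of_pow_lt_pow_left₀ a (hs.trans hsr.le) (by rwa [hroot])
    have ht : 0 ≤ t := hs.trans h1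
    refine ⟨max t (‖v a‖ ^ ((a : ℝ)⁻¹)), le_max_of_le_left h1, max_lt h2 h4, fun m hm => ?_⟩
    rcases Finset.mem_insert.1 hm with rfl | hm
    · calc ‖v m‖ = (‖v m‖ ^ ((m : ℝ)⁻¹)) ^ m := hroot.symm
        _ ≤ _ := pow_le_pow_left₀ (by positivity) (le_max_right _ _) m
    · exact (h3 m hm).trans (pow_le_pow_left₀ ht (le_max_left _ _) m)

/-- The extremal radius of a finite family: `r = max |v_m|^{1/m}`. -/
theorem exists_extremal_radius {F : Type*} [NormedField F] (T : Finset ℕ) (hT : T.Nonempty)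
    (hT0 : ∀ m ∈ T, m ≠ 0) (v : ℕ → F) :
    ∃ r : ℝ, 0 ≤ r ∧ (∀ m ∈ T, ‖v m‖ ≤ r ^ m) ∧ ∃ m ∈ T, ‖v m‖ = r ^ m := by
  obtain ⟨m, hm, hmax⟩ := Finset.exists_max_image T (fun m => ‖v m‖ ^ ((m : ℝ)⁻¹)) hT
  have hroot : ∀ a ∈ T, (‖v a‖ ^ ((a : ℝ)⁻¹)) ^ a = ‖v a‖ := fun a ha =>
    Real.rpow_inv_natCast_pow (norm_nonneg _) (hT0 a ha)
  refine ⟨‖v m‖ ^ ((m : ℝ)⁻¹), by positivity, fun a ha => ?_, m, hm, (hroot m hm).symm⟩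
  rw [← hroot a ha]
  exact pow_le_pow_left₀ (by positivity) (hmax a ha) a

theorem exists_lt_mul_pow {C s r a : ℝ} (hs : 0 ≤ s) (hsr : s < r) (ha : 0 < a) :
    ∃ N : ℕ, ∀ n ≥ N, C * s ^ n < a * r ^ n := by
  have hr : 0 < r := hs.trans_lt hsr
  have h := (tendsto_pow_atTop_nhds_zero_of_lt_one (div_nonneg hs hr.le)
    ((div_lt_one hr).2 hsr)).const_mul C
  rw [mul_zero] at h
  obtain ⟨N, hN⟩ := Filter.eventually_atTop.1 (h.eventually_lt_const ha)
  refine ⟨N, fun n hn => ?_⟩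
  have := hN n hn
  rwa [div_pow, ← mul_div_assoc, div_lt_iff₀ (pow_pos hr n)] at this

/-- If all `|v_m| = r^m`, the product of the quotients of Artin–Hasse exponentials does not
converge on a disc of radius larger than `1 / r`. -/
theorem not_growthBound_prod_artinHasseQuot (hE : GrowthBound 1 1 (artinHasse p L))
    (hpL : ‖(p : L)‖ < 1) {ζ : L} (hζ : IsPrimitiveRoot ζ (p ^ (dIndex p D 1 + 1)))
    {S : Finset ℕ} (hS : S.Nonempty) (hSD : S ⊆ Finset.Icc 1 D) {v : ℕ → L} {r : ℝ}
    (hv : ∀ m ∈ S, ‖v m‖ = r ^ m) {c s : ℝ} (hs : 0 ≤ s) (hsr : s < r) :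
    ¬ GrowthBound c s (∏ m ∈ S,
      artinHasseQuot p (ζ ^ p ^ (dIndex p D 1 - dIndex p D m)) (v m) m) := by
  intro hgb
  have hr : 0 < r := hs.trans_lt hsr
  set z : ℕ → L := fun m => ζ ^ p ^ (dIndex p D 1 - dIndex p D m) with hz
  have hS1 : ∀ m ∈ S, 1 ≤ m := fun m hm => (Finset.mem_Icc.1 (hSD hm)).1
  have hS0 : ∀ m ∈ S, m ≠ 0 := fun m hm => Nat.one_le_iff_ne_zero.1 (hS1 m hm)
  have hζ1 : ‖ζ‖ = 1 := by
    have h := congrArg norm hζ.pow_eq_one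
    rw [norm_pow, norm_one] at h
    exact (pow_eq_one_iff_of_nonneg (norm_nonneg ζ) (pow_ne_zero _ hp.out.ne_zero)).1 h
  have hz1 : ∀ m, ‖z m‖ ≤ 1 := fun m => by rw [hz]; simp [hζ1]
  -- The least index has the largest `d_m`, so `z_{m₀}` has the largest order among the roots of
  -- unity that occur.
  set m₀ := S.min' hS with hm₀
  have hm₀S : m₀ ∈ S := S.min'_mem hS
  have hmin : ∀ m ∈ S, m₀ ≤ m := fun m hm => S.min'_le m hm
  set a := z m₀ - 1 with ha
  have ha0 : 0 < ‖a‖ := norm_pos_iff.2 (sub_ne_zero.2 (zeta_ne_one hp.out.one_lt hζ m₀))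
  have ha1 : ‖a‖ < 1 := norm_sub_one_lt_one hp.out hpL (k := dIndex p D m₀ + 1)
    (zeta_pow_eq_one hζ (hS1 _ hm₀S) (Nat.lt_succ_self _))
  -- `b` bounds every error: the quadratic terms, and the factors with `d_m < d_{m₀}`, for which
  -- `z_m` is a power of `z_{m₀}^p`.
  set b := max (‖a‖ ^ 2) ‖z m₀ ^ p - 1‖ with hb
  have hba : b < ‖a‖ := max_lt (by nlinarith)
    (norm_pow_prime_sub_one_lt hp.out hpL ha1 (zeta_ne_one hp.out.one_lt hζ m₀))
  have hb0 : 0 ≤ b := le_max_of_le_left (by positivity)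
  have hd : ∀ m ∈ S, dIndex p D m ≤ dIndex p D m₀ := fun m hm =>
    dIndex_antitone (hS1 _ hm₀S) (hmin m hm)
  have hzlt : ∀ m ∈ S, dIndex p D m ≠ dIndex p D m₀ → ‖z m - 1‖ ≤ b := fun m hm hne => by
    have h1 := hd m hm
    have h2 := dIndex_antitone (p := p) (D := D) le_rfl (hS1 _ hm₀S)
    obtain ⟨k, hk⟩ : ∃ k, dIndex p D m₀ = dIndex p D m + k + 1 :=
      ⟨dIndex p D m₀ - dIndex p D m - 1, by omega⟩
    have h3 : z m = (z m₀ ^ p) ^ p ^ k := by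
      rw [hz]
      simp only
      rw [← pow_mul, ← pow_mul, ← pow_succ', ← pow_add]
      congr 2
      omega
    rw [h3]
    refine (norm_pow_sub_one_le ?_ _).trans (le_max_right _ _)
    rw [norm_pow]; exact pow_le_one₀ (norm_nonneg _) (hz1 _)
  set N : ℕ → PowerSeries L := fun m =>
    if dIndex p D m = dIndex p D m₀ then dilate (v m) m (logDerivArtinHasse p L) else 0 with hN
  have hN1 : ∀ m ∈ S, GrowthBound 1 r (N m) := fun m hm => by
    rw [hN]
    dsimp only
    split_ifs
    · exact growthBound_logDerivArtinHasse.dilate zero_le_one (hS0 m hm) hr.le (hv m hm).le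
    · intro i; rw [map_zero, norm_zero]; positivity
  have hlin := growthBound_prod_sub_linear (S := S) (h := fun m => artinHasseQuot p (z m) (v m) m)
    (N := N) (a := a) (c := b) hr.le (le_max_left _ _) hba.le ha1.le hN1 fun m hm => by
      rw [hN]
      dsimp only
      split_ifs with hdm
      · have h1 : a = z m - 1 := by rw [ha, hz]; simp only [hdm]
        rw [h1]
        refine (growthBound_artinHasseQuot_sub_linear hE (hS0 m hm) hr.le (hz1 m)
          (hv m hm).le).mono ?_ hr.le
        rw [← h1]; exact le_max_left _ _
      · rw [mul_zero, sub_zero]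
        exact (growthBound_artinHasseQuot_sub_one hE (hS0 m hm) hr.le (hz1 m) (hv m hm).le).mono
          (hzlt m hm hdm) hr.le
  -- Another index `m` contributing in degree `m₀ p^j` would be `m₀` times a positive power of `p`.
  -- Then `d_m < d_{m₀}`, and its term was put to zero in `N`.
  have hcoeff : ∀ j, coeff (m₀ * p ^ j) (∑ m ∈ S, N m) = v m₀ ^ p ^ j := fun j => by
    rw [map_sum, Finset.sum_eq_single m₀]
    · rw [hN]
      dsimp only
      rw [if_pos rfl, coeff_dilate _ (hS0 _ hm₀S), if_pos (dvd_mul_right _ _),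
        Nat.mul_div_cancel_left _ (hS1 _ hm₀S), coeff_logDerivArtinHasse,
        Nat.log_pow hp.out.one_lt, if_pos ⟨pow_ne_zero _ hp.out.ne_zero, rfl⟩, mul_one]
    · intro m hm hne
      rw [hN]
      dsimp only
      split_ifs with hdm
      · rw [coeff_dilate _ (hS0 m hm)]
        split_ifs with hdvd
        · obtain ⟨k, hk⟩ := hdvd
          rw [hk, Nat.mul_div_cancel_left _ (hS1 m hm), coeff_logDerivArtinHasse, if_neg, mul_zero]
          rintro ⟨-, hkp⟩
          set i := Nat.log p k
          rw [hkp] at hk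
          have hle : i ≤ j := by
            by_contra hlt
            have h1 : p ^ j < p ^ i := Nat.pow_lt_pow_right hp.out.one_lt (by omega)
            have h2 := hmin m hm
            have h3 := hS1 _ hm₀S
            nlinarith
          have hpi : 0 < p ^ i := pow_pos hp.out.pos i
          have h1 : m₀ * p ^ (j - i) = m := by
            apply Nat.eq_of_mul_eq_mul_right hpi
            rw [mul_assoc, ← pow_add, Nat.sub_add_cancel hle, hk]
          have h2 : j - i ≤ dIndex p D m₀ := le_dIndex hp.out.one_lt (hS1 _ hm₀S)
            (h1 ▸ (Finset.mem_Icc.1 (hSD hm)).2)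
          have h3 := dIndex_mul_pow (p := p) (D := D) m₀ (j - i)
          rw [h1, hdm] at h3
          have h4 : j - i = 0 := by omega
          rw [h4, pow_zero, mul_one] at h1
          exact hne h1.symm
        · rfl
      · rw [map_zero]
    · exact fun h => absurd hm₀S h
  obtain ⟨M, hM⟩ := exists_lt_mul_pow (C := c) hs hsr ha0
  set n := m₀ * p ^ M with hn
  have hnM : M ≤ n := (Nat.lt_pow_self hp.out.one_lt).le.trans
    (Nat.le_mul_of_pos_left _ (hS1 _ hm₀S))
  have hn0 : n ≠ 0 := mul_ne_zero (hS0 _ hm₀S) (pow_ne_zero _ hp.out.ne_zero)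
  have h1 := hlin n
  rw [map_sub, map_sub, coeff_one, if_neg hn0, sub_zero, coeff_C_mul, hcoeff] at h1
  have h2 : ‖a * v m₀ ^ p ^ M‖ = ‖a‖ * r ^ n := by
    rw [norm_mul, norm_pow, hv _ hm₀S, ← pow_mul]
  -- The actual coefficient is at most `c s^n < ‖a‖ r^n` by the choice of `M`, and its distance from
  -- the main term is at most `b r^n < ‖a‖ r^n`.
  have h3 : ‖a * v m₀ ^ p ^ M‖ < ‖a‖ * r ^ n := by
    set y := coeff n (∏ m ∈ S, artinHasseQuot p (z m) (v m) m) with hy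
    rw [show a * v m₀ ^ p ^ M = y - (y - a * v m₀ ^ p ^ M) by ring]
    refine (norm_sub_le_max _ _).trans_lt (max_lt ((hgb n).trans_lt (hM n hnM)) (h1.trans_lt ?_))
    exact mul_lt_mul_of_pos_right hba (pow_pos hr n)
  exact h3.ne h2

/-- If a quotient of products of Artin–Hasse exponentials has coefficients
bounded by `c s^i`, then `|v_m| ≤ s^m` for all `m`. -/
theorem norm_le_of_growthBound_prod (hE : GrowthBound 1 1 (artinHasse p L))
    (hpL : ‖(p : L)‖ < 1) {ζ : L} (hζ : IsPrimitiveRoot ζ (p ^ (dIndex p D 1 + 1)))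
    {v : ℕ → L} {c s : ℝ} (hc : 0 ≤ c) (hs : 0 ≤ s)
    (h : GrowthBound c s (∏ m ∈ Finset.Icc 1 D,
      artinHasseQuot p (ζ ^ p ^ (dIndex p D 1 - dIndex p D m)) (v m) m)) :
    ∀ m ∈ Finset.Icc 1 D, ‖v m‖ ≤ s ^ m := by
  classical
  by_contra! hcon
  obtain ⟨m₁, hm₁, hlt⟩ := hcon
  have h0 : ∀ m ∈ Finset.Icc 1 D, m ≠ 0 := fun m hm => by
    have := Finset.mem_Icc.1 hm; omega
  obtain ⟨r, hr, hle, m₂, hm₂, heq⟩ := exists_extremal_radius _ ⟨m₁, hm₁⟩ h0 v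
  have hsr : s < r := lt_of_pow_lt_pow_left₀ m₁ hr (hlt.trans_le (hle m₁ hm₁))
  have hζ1 : ‖ζ‖ = 1 := by
    have h := congrArg norm hζ.pow_eq_one
    rw [norm_pow, norm_one] at h
    exact (pow_eq_one_iff_of_nonneg (norm_nonneg ζ) (pow_ne_zero _ hp.out.ne_zero)).1 h
  -- Finiteness of the family yields a single `t < r` that serves both for the non-extremal `v_m`
  -- and for the assumed bound in `s`.
  obtain ⟨t, hst, htr, ht⟩ := exists_lt_forall_norm_le_pow
    ((Finset.Icc 1 D).filter fun m => ¬ ‖v m‖ = r ^ m) v hs hsr fun m hm => by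
      obtain ⟨hm, hne⟩ := Finset.mem_filter.1 hm
      exact ⟨h0 m hm, (hle m hm).lt_of_ne hne⟩
  have ht0 : 0 ≤ t := hs.trans hst
  refine not_growthBound_prod_artinHasseQuot (S := (Finset.Icc 1 D).filter fun m => ‖v m‖ = r ^ m)
    hE hpL hζ ⟨m₂, Finset.mem_filter.2 ⟨hm₂, heq⟩⟩ (Finset.filter_subset _ _)
    (fun m hm => (Finset.mem_filter.1 hm).2) ht0 htr (c := c) ?_
  rw [← Finset.prod_filter_mul_prod_filter_not _ fun m => ‖v m‖ = r ^ m] at h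
  set A := ∏ m ∈ (Finset.Icc 1 D).filter (fun m => ‖v m‖ = r ^ m),
    artinHasseQuot p (ζ ^ p ^ (dIndex p D 1 - dIndex p D m)) (v m) m
  set B := ∏ m ∈ (Finset.Icc 1 D).filter (fun m => ¬ ‖v m‖ = r ^ m),
    artinHasseQuot p (ζ ^ p ^ (dIndex p D 1 - dIndex p D m)) (v m) m
  have hB : GrowthBound 1 t B := GrowthBound.prod ht0 fun m hm =>
    growthBound_artinHasseQuot hE (h0 m (Finset.mem_filter.1 hm).1) ht0 (by simp [hζ1]) (ht m hm)
  have hB0 : constantCoeff B = 1 := by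
    rw [map_prod]
    exact Finset.prod_eq_one fun m hm =>
      constantCoeff_artinHasseQuot _ _ (h0 m (Finset.mem_filter.1 hm).1)
  -- Dividing by the non-extremal factors costs nothing at radius `t`, so the extremal part inherits
  -- a bound with `t < r`.
  have hA : A = B⁻¹ * (A * B) := by
    rw [mul_left_comm, PowerSeries.inv_mul_cancel _ (by rw [hB0]; exact one_ne_zero), mul_one]
  rw [hA]
  exact (hB.inv ht0 hB0).mul_one_left (h.mono_right hc hs hst) hc ht0

end LowerBound

/-! ### Radii in `[0, ∞]` in terms of geometric bounds -/

section Radius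

theorem iSup_root_le_iff {F : Type*} [NormedField F] {s : Set ℕ} (hs : ∀ i ∈ s, i ≠ 0)
    (a : ℕ → F) (r : NNReal) :
    (⨆ i ∈ s, ‖a i‖ₑ ^ (1 / (i : ℝ))) ≤ (r : ℝ≥0∞) ↔ ∀ i ∈ s, ‖a i‖ ≤ (r : ℝ) ^ i := by
  rw [iSup₂_le_iff]
  refine forall₂_congr fun i hi => ?_
  have h0 : (0 : ℝ) < i := by exact_mod_cast Nat.pos_of_ne_zero (hs i hi)
  rw [one_div, ENNReal.rpow_inv_le_iff h0, ENNReal.rpow_natCast, ← ENNReal.coe_pow, enorm_le_coe,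
    ← NNReal.coe_le_coe, coe_nnnorm, NNReal.coe_pow]

/-- An element of `[0, ∞]` is determined by its upper bounds, so equality of radii reduces to
equivalence of bounds `|a_i| ≤ r^i` for real `r ≥ 0`. -/
theorem invSupRoot_congr {F G : Type*} [NormedField F] [NormedField G] {s t : Set ℕ}
    (hs : ∀ i ∈ s, i ≠ 0) (ht : ∀ i ∈ t, i ≠ 0) {a : ℕ → F} {b : ℕ → G}
    (h : ∀ r : ℝ, 0 ≤ r → ((∀ i ∈ s, ‖a i‖ ≤ r ^ i) ↔ ∀ i ∈ t, ‖b i‖ ≤ r ^ i)) :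
    invSupRoot s a = invSupRoot t b := by
  have key : ∀ x : ℝ≥0∞, (⨆ i ∈ s, ‖a i‖ₑ ^ (1 / (i : ℝ))) ≤ x
      ↔ (⨆ i ∈ t, ‖b i‖ₑ ^ (1 / (i : ℝ))) ≤ x := fun x => by
    induction x with
    | top => simp
    | coe r => rw [iSup_root_le_iff hs, iSup_root_le_iff ht, h r r.2]
  rw [invSupRoot, invSupRoot, eq_of_forall_ge_iff key]

theorem inv_le_invSupRoot_iff {F : Type*} [NormedField F] {s : Set ℕ} (hs : ∀ i ∈ s, i ≠ 0)
    (a : ℕ → F) (r : NNReal) :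
    (r : ℝ≥0∞)⁻¹ ≤ invSupRoot s a ↔ ∀ i ∈ s, ‖a i‖ ≤ (r : ℝ) ^ i := by
  rw [invSupRoot, ENNReal.inv_le_inv, iSup_root_le_iff hs]

/-- The radius of convergence is the integrality radius when geometric bounds on the coefficients
hold with constant `1` as soon as they hold with some constant. -/
theorem convRadius_eq_integralityRadius {F : Type*} [NontriviallyNormedField F] {f : PowerSeries F}
    (h0 : constantCoeff f = 1)
    (h : ∀ c s : ℝ, 0 ≤ c → 0 ≤ s → GrowthBound c s f → ∀ i ∈ Set.Ici 1, ‖coeff i f‖ ≤ s ^ i) :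
    convRadius f = integralityRadius f := by
  have hI : ∀ i ∈ Set.Ici 1, i ≠ 0 := fun i hi => Nat.one_le_iff_ne_zero.1 hi
  apply le_antisymm
  · refine ENNReal.le_of_forall_nnreal_lt fun t ht => ?_
    rcases eq_or_ne t 0 with rfl | ht0
    · simp
    obtain ⟨c, hc, hb⟩ := FormalMultilinearSeries.norm_mul_pow_le_of_lt_radius _ ht
    rw [← inv_inv t, ENNReal.coe_inv (inv_ne_zero ht0), integralityRadius,
      inv_le_invSupRoot_iff hI]
    refine h c _ hc.le (by positivity) fun i => ?_
    have := hb i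
    rw [FormalMultilinearSeries.ofScalars_norm] at this
    have htp : (0 : ℝ) < t := by positivity
    rwa [NNReal.coe_inv, inv_pow, ← div_eq_mul_inv, le_div_iff₀ (pow_pos htp i)]
  · refine ENNReal.le_of_forall_nnreal_lt fun t ht => ?_
    rcases eq_or_ne t 0 with rfl | ht0
    · simp
    have htp : (0 : ℝ) < t := by positivity
    rw [← inv_inv t, ENNReal.coe_inv (inv_ne_zero ht0)] at ht
    have hb := (inv_le_invSupRoot_iff hI _ _).1 ht.le
    refine FormalMultilinearSeries.le_radius_of_bound _ 1 fun i => ?_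
    rw [FormalMultilinearSeries.ofScalars_norm]
    rcases Nat.eq_zero_or_pos i with rfl | hi
    · simp [h0]
    · have := hb i hi
      rwa [NNReal.coe_inv, inv_pow, ← one_div, le_div_iff₀ (pow_pos htp i)] at this

end Radius
end PadicExp

/-! ### Comparison of the four radii -/

theorem mainTheorem8 (p : ℕ) [Fact p.Prime]
    {K : Type*} [NontriviallyNormedField K] [NormedAlgebra ℚ_[p] K] [IsUltrametricDist K] [CharZero K]
    {L : Type*} [NormedField L] [NormedAlgebra K L] [IsUltrametricDist L] [CharZero L]
    (D : ℕ) (hD : 1 ≤ D)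
    (ζ : L) (hζ : IsPrimitiveRoot ζ (p ^ (PadicExp.dIndex p D 1 + 1)))
    (P : Polynomial K) (hP0 : P.coeff 0 = 0) (hPD : P.natDegree ≤ D) :
    PadicExp.convRadius (PadicExp.expSeries (P : PowerSeries K))
        = PadicExp.integralityRadius (PadicExp.expSeries (P : PowerSeries K))
      ∧ PadicExp.integralityRadius (PadicExp.expSeries (P : PowerSeries K))
        = PadicExp.invSupRoot (Set.Icc 1 D) (fun i => (PadicExp.tildeExp p D ζ P).coeff i)
      ∧ PadicExp.invSupRoot (Set.Icc 1 D) (fun i => (PadicExp.tildeExp p D ζ P).coeff i)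
        = PadicExp.invSupRoot (Set.Icc 1 D)
            (PadicExp.wittCoord (PadicExp.tildeExp p D ζ P : PowerSeries L))
      ∧ (1 ≤ PadicExp.convRadius (PadicExp.expSeries (P : PowerSeries K))
          ↔ ∀ i, ‖PowerSeries.coeff i (PadicExp.expSeries (P : PowerSeries K))‖ ≤ 1) := by
  open PadicExp in
  have hφ : ∀ x : ℚ_[p], ‖(algebraMap K L).comp (algebraMap ℚ_[p] K) x‖ = ‖x‖ := fun x => by
    rw [RingHom.comp_apply, norm_algebraMap', norm_algebraMap']
  have hE := growthBound_artinHasse _ hφ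
  have hpL : ‖(p : L)‖ < 1 := by
    have := hφ p
    rw [map_natCast] at this
    rw [this]; exact Padic.norm_p_lt_one
  have hE0 : constantCoeff (artinHasse p L) = 1 := constantCoeff_artinHasse
  have hE1 : ‖coeff 1 (artinHasse p L)‖ = 1 := by rw [coeff_one_artinHasse, norm_one]
  have hζ1 : ‖ζ‖ = 1 := by
    have h := congrArg norm hζ.pow_eq_one
    rw [norm_pow, norm_one] at h
    exact (pow_eq_one_iff_of_nonneg (norm_nonneg ζ)
      (pow_ne_zero _ (Fact.out : p.Prime).ne_zero)).1 h
  obtain ⟨v, hv⟩ := exists_coeff_sum_dilate_eq (e := artinHasseLog p L)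
    (by simpa using coeff_artinHasseLog_pow (p := p) (F := L) 0)
    (tildePoly p D ζ P : PowerSeries L) D
  have hI : ∀ i ∈ Finset.Icc 1 D, i ≠ 0 := fun i hi => by have := Finset.mem_Icc.1 hi; omega
  have hIc : ∀ i ∈ Set.Icc 1 D, i ≠ 0 := fun i hi => by have := hi.1; omega
  have hIi : ∀ i ∈ Set.Ici 1, i ≠ 0 := fun i hi => Nat.one_le_iff_ne_zero.1 hi
  set f : PowerSeries K := expSeries (P : PowerSeries K) with hf
  have hf0 : constantCoeff f = 1 := constantCoeff_expSeries (by
    rw [← coeff_zero_eq_constantCoeff_apply, Polynomial.coeff_coe, hP0])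
  have hfL : PowerSeries.map (algebraMap K L) f = ∏ m ∈ Finset.Icc 1 D,
      artinHasseQuot p (ζ ^ p ^ (dIndex p D 1 - dIndex p D m)) (v m) m := by
    have h1 := map_expSeries_mul_prod_dilate hζ hP0 hPD hv
    have h2 : ∏ m ∈ Finset.Icc 1 D, dilate (v m) m (artinHasse p L)
        * (dilate (v m) m (artinHasse p L))⁻¹ = 1 := Finset.prod_eq_one fun m hm =>
      PowerSeries.mul_inv_cancel _ (constantCoeff_dilate_artinHasse_ne_zero _ (hI m hm))
    rw [Finset.prod_mul_distrib] at h2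
    simp only [artinHasseQuot]
    rw [Finset.prod_mul_distrib, ← h1, mul_assoc, h2, mul_one]
  have hnorm : ∀ i, ‖coeff i (PowerSeries.map (algebraMap K L) f)‖ = ‖coeff i f‖ := fun i => by
    rw [coeff_map, norm_algebraMap']
  have hup : ∀ r : ℝ, 0 ≤ r → (∀ m ∈ Finset.Icc 1 D, ‖v m‖ ≤ r ^ m) →
      ∀ i, ‖coeff i f‖ ≤ r ^ i := fun r hr h i => by
    have h1 : GrowthBound 1 r (PowerSeries.map (algebraMap K L) f) := by
      rw [hfL]
      exact GrowthBound.prod hr fun m hm =>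
        growthBound_artinHasseQuot hE (hI m hm) hr (by simp [hζ1]) (h m hm)
    have h2 := h1 i
    rwa [hnorm, one_mul] at h2
  have hlow : ∀ c s : ℝ, 0 ≤ c → 0 ≤ s → GrowthBound c s f →
      ∀ m ∈ Finset.Icc 1 D, ‖v m‖ ≤ s ^ m := fun c s hc hs h => by
    refine norm_le_of_growthBound_prod hE hpL hζ hc hs ?_
    rw [← hfL]
    intro i
    rw [hnorm]
    exact h i
  -- The `v_m` are the common term of comparison: the bounds on `e` and those on `ẽ` are each
  -- equivalent to the bounds on `v`.
  have hiff : ∀ r : ℝ, 0 ≤ r → ((∀ i ∈ Set.Ici 1, ‖coeff i f‖ ≤ r ^ i)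
      ↔ ∀ m ∈ Finset.Icc 1 D, ‖v m‖ ≤ r ^ m) := fun r hr => by
    refine ⟨fun h => hlow 1 r zero_le_one hr fun i => ?_, fun h i _ => hup r hr h i⟩
    rw [one_mul]
    rcases Nat.eq_zero_or_pos i with rfl | hi
    · simp [hf0]
    · exact h i hi
  have htilde : ∀ r : ℝ, 0 ≤ r → ((∀ i ∈ Finset.Icc 1 D, ‖(tildeExp p D ζ P).coeff i‖ ≤ r ^ i)
      ↔ ∀ m ∈ Finset.Icc 1 D, ‖v m‖ ≤ r ^ m) := fun r hr => by
    rw [← forall_coeff_prod_dilate_le_iff hE hE0 hE1 v hr D]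
    refine forall₂_congr fun i hi => ?_
    rw [coeff_tildeExp_eq hv (Finset.mem_Icc.1 hi).2]
  -- A bound with constant `c` passes to the `v_m`, where the constant disappears, and returns to
  -- `e` with constant `1`.
  have hconv : convRadius f = integralityRadius f :=
    convRadius_eq_integralityRadius hf0 fun c s hc hs h i _ => hup s hs (hlow c s hc hs h) i
  refine ⟨hconv, ?_, ?_, ?_⟩
  · refine invSupRoot_congr hIi hIc fun r hr => ?_
    rw [hiff r hr, ← htilde r hr]
    simp only [Finset.mem_Icc, Set.mem_Icc]
  · refine invSupRoot_congr hIc hIc fun r hr => ?_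
    have h := forall_coeff_le_iff_wittCoord (f := (tildeExp p D ζ P : PowerSeries L)) (by
      rw [← coeff_zero_eq_constantCoeff_apply, Polynomial.coeff_coe,
        coeff_tildeExp_eq hv (Nat.zero_le D), coeff_zero_eq_constantCoeff_apply,
        constantCoeff_prod_dilate hE0]) hr D
    simpa only [Finset.mem_Icc, Set.mem_Icc, Polynomial.coeff_coe] using h
  · have h := inv_le_invSupRoot_iff hIi (fun i => coeff i f) 1
    rw [ENNReal.coe_one, inv_one] at h
    rw [hconv, integralityRadius, h]
    simp only [NNReal.coe_one, one_pow]
    refine ⟨fun h i => ?_, fun h i _ => h i⟩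
    rcases Nat.eq_zero_or_pos i with rfl | hi
    · simp [hf0]
    · exact h i hi
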